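/- Let $L_0(x)=x$ and $L_{k+1}(x)=\log(e+L_k(x))$ for $k\ge 0$, $x\ge 0$. Let $(\delta_j)_{j\ge 1}$ be a sequence with $\delta_j>0$ for all $j\ge1$ and $\sum_{j=1}^\infty\delta_j<\infty$, and put, for $Z\ge 0$, $$F_1^\infty(Z)=L_1(Z)\prod_{j=2}^\infty(1+L_j(Z))^{-\delta_j},\qquad F_2^\infty(Z)=\frac{1}{L_1(Z)}\prod_{j=2}^\infty(1+L_j(Z))^{\delta_j}.$$ Then both infinite products converge for every $Z\ge0$, and there is a constant $C>0$, depending only on $(\delta_j)$, such that for every $\sigma\in(0,1/2)$ and every smooth, compactly supported, divergence-free vector field $u:\mathbb R^3\to\mathbb R^3$, $$\|[(-\Delta)^{1/2},u\cdot\nabla]u\|_{L^2}\le C\,\|\nabla u\|_{L^\infty}\,\|(-\Delta)^{1/2}u\|_{L^2}\,F_1^\infty(Z)+C\,\|\nabla u\|_{L^\infty}\,\|(-\Delta)u\|_{L^2}\,F_2^\infty(Z),\qquad Z=\|(-\Delta)^{1/2+\sigma}u\|_{L^2},$$ where all the norms that occur are finite. Here $(-\Delta)^s$ is the Fourier multiplier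 operator with symbol $|\xi|^{2s}$ (with respect to the Fourier transform with kernel $e^{-ix\cdot\xi}$), and $[(-\Delta)^{1/2},u\cdot\nabla]u=(-\Delta)^{1/2}((u\cdot\nabla)u)-(u\cdot\nabla)((-\Delta)^{1/2}u)$. -/

import Mathlib

open MeasureTheory FourierTransform
open scoped ContDiff ENNReal

noncomputable section

/-- Euclidean space `ℝ³`. -/
abbrev R3 : Type := EuclideanSpace ℝ (Fin 3)

/-- The complexification `ℂ³` of `ℝ³`, with its Hermitian norm. -/
abbrev C3 : Type := EuclideanSpace ℂ (Fin 3)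

/-- A real vector field, regarded as a `ℂ³`-valued function (componentwise inclusion `ℝ ⊆ ℂ`), so
that its Fourier transform can be taken. The inclusion preserves norms. -/
def complexify (u : R3 → R3) : R3 → C3 :=
  fun x => WithLp.toLp 2 (fun i => ((u x i : ℝ) : ℂ))

/-- `(-Δ)^s f`, the Fourier multiplier operator with symbol `|ω|^(2s)`, where `ω` is the angular
frequency. Mathlib's Fourier transform `𝓕` has kernel `exp (-2πi⟨x, ξ⟩)`, so `ω = 2πξ`. -/
def fracLaplacian {F : Type*} [NormedAddCommGroup F] [NormedSpace ℂ F]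
    (s : ℝ) (f : R3 → F) : R3 → F :=
  𝓕⁻ (fun ξ : R3 => (((2 * Real.pi * ‖ξ‖) ^ (2 * s) : ℝ) : ℂ) • 𝓕 f ξ)

/-- `(u · ∇) w = ∑ i, u_i ∂_i w`, the derivative of `w` in the direction `u`. -/
def advect {F : Type*} [NormedAddCommGroup F] [NormedSpace ℝ F]
    (u : R3 → R3) (w : R3 → F) : R3 → F :=
  fun x => fderiv ℝ w x (u x)

/-- The commutator `[(-Δ)^s, u · ∇] u = (-Δ)^s ((u · ∇) u) - (u · ∇) ((-Δ)^s u)`. -/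
def advectionCommutator (s : ℝ) (u : R3 → R3) : R3 → C3 :=
  fun x => fracLaplacian s (advect u (complexify u)) x
    - advect u (fracLaplacian s (complexify u)) x

/-- `∇ · u = 0` on `ℝ³`. -/
def DivergenceFree (u : R3 → R3) : Prop :=
  ∀ x, ∑ i : Fin 3, (fderiv ℝ u x (EuclideanSpace.single i 1)) i = 0

/-- The `L²(ℝ³)` norm (a real number, meaningful for functions in `L²`). -/
def normL2 {F : Type*} [NormedAddCommGroup F] (f : R3 → F) : ℝ :=
  (eLpNorm f 2 volume).toReal

/-- The `L^∞(ℝ³)` norm (a real number, meaningful for functions in `L^∞`). -/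
def normLinf {F : Type*} [NormedAddCommGroup F] (f : R3 → F) : ℝ :=
  (eLpNorm f ∞ volume).toReal

/-- Nested logarithms: `L_0(x) = x` and `L_(k+1)(x) = log (e + L_k(x))`. -/
def nestedLog : ℕ → ℝ → ℝ
  | 0, x => x
  | k + 1, x => Real.log (Real.exp 1 + nestedLog k x)

/-- `F₁(Z) = L_1(Z) ∏_{j ≥ 2} (1 + L_j(Z))^(-δ_j)`; the factor of index `j` here is the one
that belongs to `j + 2`. -/
def logFactorOne (δ : ℕ → ℝ) (Z : ℝ) : ℝ :=
  nestedLog 1 Z * ∏' j : ℕ, (1 + nestedLog (j + 2) Z) ^ (-δ (j + 2))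

/-- `F₂(Z) = (1 / L_1(Z)) ∏_{j ≥ 2} (1 + L_j(Z))^(δ_j)`. -/
def logFactorTwo (δ : ℕ → ℝ) (Z : ℝ) : ℝ :=
  1 / nestedLog 1 Z * ∏' j : ℕ, (1 + nestedLog (j + 2) Z) ^ (δ (j + 2))

end

/-! A stronger estimate holds without the logarithmic factors: writing `Λ = (-Δ)^(1/2)`, the
commutator satisfies `‖[Λ, u·∇]u‖₂ ≤ C ‖∇u‖_∞ ‖Λu‖₂` (`normL2_advectionCommutator_le`). The stated
inequality follows because `F₁` is bounded below by a positive constant (`exists_le_logFactorOne`)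
and `F₂ ≥ 0`. The lower bound holds since every `L_j` with `j ≥ 2` is at most `2 + L_2`, so the
product costs only a fixed power of `3 + L_2 ~ log L_1`, which `L_1` absorbs.

The commutator estimate is proved by duality on the Fourier side. With frequencies `ζ` for the
advecting field and `η` for the advected one, the symbol is `‖ζ+η‖ - ‖η‖`. Put `a = ‖ζ‖`, `b = ‖η‖`,
`c = ‖ζ+η‖`, `S = a + b + c`. An algebraic identity together with `ζ · û(ζ) = 0` writes the
trilinear form as a finite sum of forms with symbols `b^(k+1) c / S^(k+2)` or `a^(k+1) c / S^(k+2)`,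
`k = 0, 1` (`commutatorSymbol_eq`). In each of them one factor is a Fourier transform of a component
of `∇u`, to be measured in `L^∞`, and the other is of the size of `‖ξ‖ û`, measured in `L²`.

These symbols are bounded on `L^∞ × L²` (`norm_integral_bilinearSymbol_le`): `S^(-(k+2))` is a
Laplace integral of `t^(k+1) exp(-tS)`, and the exponential splits into one Poisson factor per
frequency. The Poisson extension of the `L^∞` factor obeys the maximum principle, proved by
subordination to the heat semigroup, and the other two factors give square functions whose
`t`-integrals are controlled by Plancherel. -/

/-! ### Plancherel's theorem for the Fourier integral on `L¹ ∩ L²`. -/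

section Plancherel

variable {V F : Type*} [NormedAddCommGroup V] [InnerProductSpace ℝ V] [FiniteDimensional ℝ V]
  [MeasurableSpace V] [BorelSpace V] [NormedAddCommGroup F] [InnerProductSpace ℂ F]
  [CompleteSpace F]

theorem continuous_fourierInv_of_integrable {F : Type*} [NormedAddCommGroup F] [NormedSpace ℂ F]
    {g : V → F} (h1 : Integrable g) : Continuous (𝓕⁻ g) := by
  have : 𝓕⁻ g = fun w => 𝓕 g (-w) := by
    ext w; exact Real.fourierInv_eq_fourier_neg g w
  rw [this]
  exact (VectorFourier.fourierIntegral_continuous Real.continuous_fourierChar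
    (L := innerₗ V) continuous_inner h1).comp continuous_neg

theorem integral_schwartz_smul_fourierInv {g : V → F} (h1 : Integrable g)
    (φ : SchwartzMap V ℂ) :
    ∫ x, φ x • 𝓕⁻ g x = ∫ x, (𝓕⁻ φ : SchwartzMap V ℂ) x • g x := by
  have h := VectorFourier.integral_fourierIntegral_smul_eq_flip (L := innerₗ V)
    (μ := volume) (ν := volume) (f := (φ : V → ℂ)) (g := fun x => g (-x))
    Real.continuous_fourierChar continuous_inner φ.integrable h1.comp_neg
  rw [flip_innerₗ] at h
  rw [Real.fourierInv_eq_fourier_comp_neg]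
  refine h.symm.trans ?_
  rw [← integral_neg_eq_self]
  refine integral_congr_ae (Filter.Eventually.of_forall fun x => ?_)
  simp only [neg_neg]
  congr 1

/-- Plancherel's theorem for the inverse Fourier integral of a function in `L¹ ∩ L²`. -/
theorem memLp_fourierInv_and_eLpNorm {g : V → F} (h1 : Integrable g) (h2 : MemLp g 2) :
    MemLp (𝓕⁻ g) 2 ∧ eLpNorm (𝓕⁻ g) 2 volume = eLpNorm g 2 volume := by
  set G : Lp F 2 (volume : Measure V) := 𝓕⁻ (h2.toLp g) with hG
  have hae : (G : V → F) =ᵐ[volume] 𝓕⁻ g := by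
    -- The abstract `L²` inverse transform is identified with the integral by testing both against
    -- smooth compactly supported functions, through their action as tempered distributions.
    refine ae_eq_of_integral_contDiff_smul_eq
      ((Lp.memLp G).locallyIntegrable (by norm_num))
      (continuous_fourierInv_of_integrable h1).locallyIntegrable ?_
    intro φ hφ hc
    have hc' : HasCompactSupport (fun x => (φ x : ℂ)) := hc.comp_left (g := fun x : ℝ => (x : ℂ)) (by simp)
    let ψ : SchwartzMap V ℂ := hc'.toSchwartzMap (Complex.ofRealCLM.contDiff.comp hφ)
    have key := DFunLike.congr_fun (Lp.fourierInv_toTemperedDistribution_eq (h2.toLp g)) ψ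
    rw [Lp.toTemperedDistribution_apply, TemperedDistribution.fourierInv_apply,
      Lp.toTemperedDistribution_apply] at key
    have e1 : ∫ x, φ x • (G : V → F) x = ∫ x, ψ x • (G : V → F) x := by
      congr 1
    have e2 : ∫ x, φ x • 𝓕⁻ g x = ∫ x, ψ x • 𝓕⁻ g x := by
      congr 1
    rw [e1, e2, ← key, integral_schwartz_smul_fourierInv h1]
    refine integral_congr_ae ?_
    filter_upwards [h2.coeFn_toLp] with x hx
    rw [hx]
  refine ⟨(memLp_congr_ae hae).1 (Lp.memLp G), ?_⟩
  rw [← eLpNorm_congr_ae hae, ← eLpNorm_congr_ae h2.coeFn_toLp]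
  have : ‖G‖ = ‖h2.toLp g‖ := by
    rw [← Lp.norm_fourier_eq G, hG, FourierTransform.fourier_fourierInv_eq]
  rw [Lp.norm_def, Lp.norm_def] at this
  exact (ENNReal.toReal_eq_toReal_iff' (Lp.eLpNorm_ne_top _) (Lp.eLpNorm_ne_top _)).1 this

theorem toReal_eLpNorm_two_sq {X F : Type*} [MeasurableSpace X] {μ : Measure X}
    [NormedAddCommGroup F] {f : X → F} (hf : MemLp f 2 μ) :
    (eLpNorm f 2 μ).toReal ^ 2 = ∫ x, ‖f x‖ ^ 2 ∂μ := by
  rw [hf.eLpNorm_eq_integral_rpow_norm (by norm_num) (by norm_num), ENNReal.toReal_ofReal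
    (by positivity)]
  norm_num
  rw [← Real.sqrt_eq_rpow, Real.sq_sqrt (by positivity)]

theorem integral_norm_sq_fourierInv {g : V → F} (h1 : Integrable g) (h2 : MemLp g 2) :
    ∫ x, ‖𝓕⁻ g x‖ ^ 2 = ∫ x, ‖g x‖ ^ 2 := by
  obtain ⟨h3, h4⟩ := memLp_fourierInv_and_eLpNorm h1 h2
  rw [← toReal_eLpNorm_two_sq h3, ← toReal_eLpNorm_two_sq h2, h4]

theorem integral_norm_sq_fourier {g : V → F} (h1 : Integrable g) (h2 : MemLp g 2) :
    MemLp (𝓕 g) 2 ∧ ∫ x, ‖𝓕 g x‖ ^ 2 = ∫ x, ‖g x‖ ^ 2 := by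
  have e : 𝓕 g = fun x => 𝓕⁻ g (-x) := by
    ext x; rw [Real.fourierInv_eq_fourier_neg, neg_neg]
  rw [e]
  refine ⟨(memLp_fourierInv_and_eLpNorm h1 h2).1.comp_measurePreserving
    (Measure.measurePreserving_neg volume), ?_⟩
  rw [integral_neg_eq_self (fun x => ‖𝓕⁻ g x‖ ^ 2), integral_norm_sq_fourierInv h1 h2]

end Plancherel

/-! ### The trilinear form with one factor bounded in physical space. -/

section Bilinear

variable {V : Type*} [NormedAddCommGroup V] [InnerProductSpace ℝ V] [FiniteDimensional ℝ V]
  [MeasurableSpace V] [BorelSpace V]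

theorem memLp_two_of_integrable_of_bounded {F : Type*} [NormedAddCommGroup F] {f : V → F} (hf : Integrable f) {B : ℝ}
    (hB : ∀ x, ‖f x‖ ≤ B) : MemLp f 2 := by
  refine (memLp_two_iff_integrable_sq_norm hf.aestronglyMeasurable).2 ?_
  refine (hf.norm.const_mul B).mono' (hf.aestronglyMeasurable.norm.pow 2)
    (Filter.Eventually.of_forall fun x => ?_)
  rw [Real.norm_of_nonneg (by positivity), sq]
  exact mul_le_mul_of_nonneg_right (hB x) (norm_nonneg _)

theorem integrable_mul_mul_comp_add {α β γ : V → ℂ} (hα : Integrable α) (hβ : Integrable β)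
    (hγ : Measurable γ) {B : ℝ} (hB : ∀ x, ‖γ x‖ ≤ B) :
    Integrable (fun p : V × V => α p.1 * β p.2 * γ (p.1 + p.2)) (volume.prod volume) := by
  refine (hα.mul_prod hβ).mul_bdd (c := B) ?_ (Filter.Eventually.of_forall fun p => hB _)
  exact (hγ.comp (measurable_fst.add measurable_snd)).aestronglyMeasurable

/-- With `c η = ∫ α ζ * γ (ζ + η)` the form is `∫ β c`, and `𝓕 c = 𝓕⁻ α * 𝓕 γ`, so Plancherel gives
`‖c‖₂ ≤ M ‖γ‖₂`. Young's inequality with a free weight `l` replaces Cauchy–Schwarz, so that the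
weight can later depend on the Laplace variable. -/
theorem two_mul_norm_integral_mul_mul_comp_add_le {α β γ : V → ℂ} (hα : Integrable α) {M : ℝ}
    (hM : 0 < M) (hαM : ∀ x, ‖𝓕⁻ α x‖ ≤ M) (hβ : Integrable β) (hβ2 : MemLp β 2)
    (hγ : Integrable γ) (hγm : Measurable γ) {B : ℝ} (hB : ∀ x, ‖γ x‖ ≤ B) {l : ℝ} (hl : 0 < l) :
    2 * ‖∫ p : V × V, α p.1 * β p.2 * γ (p.1 + p.2) ∂(volume.prod volume)‖
      ≤ M * (l * ∫ x, ‖β x‖ ^ 2) + M * (l⁻¹ * ∫ x, ‖γ x‖ ^ 2) := by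
  have hγ2 := memLp_two_of_integrable_of_bounded hγ hB
  set c : V → ℂ := convolution (fun x => α (-x)) γ (ContinuousLinearMap.mul ℂ ℂ) volume with hc
  have hcv : ∀ η, c η = ∫ ζ, α ζ * γ (ζ + η) := by
    intro η
    rw [hc, convolution, ← integral_neg_eq_self]
    refine integral_congr_ae (Filter.Eventually.of_forall fun x => ?_)
    simp [add_comm]
  have hcint : Integrable c := hα.comp_neg.integrable_convolution _ hγ
  have hcB : ∀ η, ‖c η‖ ≤ (∫ ζ, ‖α ζ‖) * B := by
    intro η
    rw [hcv, ← integral_mul_const]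
    refine norm_integral_le_of_norm_le (hα.norm.mul_const B)
      (Filter.Eventually.of_forall fun x => ?_)
    rw [norm_mul]
    exact mul_le_mul_of_nonneg_left (hB _) (norm_nonneg _)
  have hc2 := memLp_two_of_integrable_of_bounded hcint hcB
  have hF : ∀ x, 𝓕 c x = 𝓕⁻ α x * 𝓕 γ x := by
    intro x
    rw [hc, Real.fourier_mul_convolution_eq hα.comp_neg hγ, Real.fourierInv_eq_fourier_comp_neg]
  have hcγ : ∫ x, ‖c x‖ ^ 2 ≤ M ^ 2 * ∫ x, ‖γ x‖ ^ 2 := by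
    rw [← (integral_norm_sq_fourier hcint hc2).2, ← (integral_norm_sq_fourier hγ hγ2).2,
      ← integral_const_mul]
    refine integral_mono ?_ ?_ ?_
    · exact (integral_norm_sq_fourier hcint hc2).1.integrable_norm_pow (by norm_num)
    · exact ((integral_norm_sq_fourier hγ hγ2).1.integrable_norm_pow (by norm_num)).const_mul _
    · intro x
      simp only [hF, norm_mul, mul_pow]
      gcongr
      exact hαM x
  have hβi : Integrable (fun x => ‖β x‖ ^ 2) := hβ2.integrable_norm_pow (by norm_num)
  have hci : Integrable (fun x => ‖c x‖ ^ 2) := hc2.integrable_norm_pow (by norm_num)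
  have e : ∫ p : V × V, α p.1 * β p.2 * γ (p.1 + p.2) ∂(volume.prod volume)
      = ∫ η, β η * c η := by
    rw [integral_prod_symm _ (integrable_mul_mul_comp_add hα hβ hγm hB)]
    refine integral_congr_ae (Filter.Eventually.of_forall fun η => ?_)
    simp only [hcv, ← integral_const_mul]
    refine integral_congr_ae (Filter.Eventually.of_forall fun ζ => ?_)
    simp only
    ring
  have h1 : ‖∫ η, β η * c η‖ ≤ ∫ η, (M * l / 2 * ‖β η‖ ^ 2 + (M * l)⁻¹ / 2 * ‖c η‖ ^ 2) := by
    refine norm_integral_le_of_norm_le ((hβi.const_mul _).add (hci.const_mul _))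
      (Filter.Eventually.of_forall fun η => ?_)
    rw [norm_mul]
    have hpos : 0 < M * l := mul_pos hM hl
    have h3 : 0 ≤ (M * l * ‖β η‖ - ‖c η‖) ^ 2 * (M * l)⁻¹ := by positivity
    have h4 : (M * l * ‖β η‖ - ‖c η‖) ^ 2 * (M * l)⁻¹
        = M * l * ‖β η‖ ^ 2 + (M * l)⁻¹ * ‖c η‖ ^ 2 - 2 * (‖β η‖ * ‖c η‖) := by
      field_simp
      ring
    linarith
  rw [integral_add (hβi.const_mul _) (hci.const_mul _), integral_const_mul,
    integral_const_mul] at h1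
  rw [e]
  have h2 : (M * l)⁻¹ * ∫ x, ‖c x‖ ^ 2 ≤ M * (l⁻¹ * ∫ x, ‖γ x‖ ^ 2) := by
    calc _ ≤ (M * l)⁻¹ * (M ^ 2 * ∫ x, ‖γ x‖ ^ 2) := by gcongr
      _ = _ := by field_simp
  linarith

end Bilinear

/-! ### Laplace integrals of powers. -/

section LaplaceIntegrals

theorem integral_pow_mul_exp_neg (k : ℕ) {r : ℝ} (hr : 0 < r) :
    ∫ t in Set.Ioi (0 : ℝ), t ^ k * Real.exp (-(r * t)) = k.factorial / r ^ (k + 1) := by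
  have h := Real.integral_rpow_mul_exp_neg_mul_Ioi (a := (k : ℝ) + 1) (by positivity) hr
  rw [Real.Gamma_nat_eq_factorial, add_sub_cancel_right, ← Nat.cast_add_one, Real.rpow_natCast] at h
  simp only [Real.rpow_natCast] at h
  rw [h]
  simp [div_eq_mul_inv, mul_comm]

theorem integrableOn_pow_mul_exp_neg (k : ℕ) {r : ℝ} (hr : 0 < r) :
    IntegrableOn (fun t => t ^ k * Real.exp (-(r * t))) (Set.Ioi (0 : ℝ)) := by
  -- A non-integrable function has integral `0` by convention, so a nonzero value of the integral
  -- proves integrability.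
  by_contra h
  have h1 := integral_undef h
  rw [integral_pow_mul_exp_neg k hr] at h1
  have : (k.factorial : ℝ) / r ^ (k + 1) ≠ 0 := by positivity
  exact this h1

theorem integrableOn_squareWeight (k : ℕ) {b : ℝ} (hb : 0 ≤ b) :
    IntegrableOn (fun t => t ^ (2 * k + 1) * b ^ (2 * k + 2) * Real.exp (-(2 * b * t)))
      (Set.Ioi (0 : ℝ)) := by
  rcases hb.eq_or_lt with rfl | hb
  · simp
  · refine ((integrableOn_pow_mul_exp_neg (2 * k + 1) (r := 2 * b) (by positivity)).const_mul
      (b ^ (2 * k + 2))).congr (Filter.Eventually.of_forall fun t => ?_)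
    simp only; ring

/-- By scaling, the integral does not depend on `b > 0`: it equals `(2k+1)! / 2^(2k+2)`. This
uniformity is what bounds the square functions. -/
theorem integral_squareWeight_le (k : ℕ) {b : ℝ} (hb : 0 ≤ b) :
    ∫ t in Set.Ioi (0 : ℝ), t ^ (2 * k + 1) * b ^ (2 * k + 2) * Real.exp (-(2 * b * t))
      ≤ (2 * k + 1).factorial := by
  rcases hb.eq_or_lt with rfl | hb
  · simp
  · have : ∀ t : ℝ, t ^ (2 * k + 1) * b ^ (2 * k + 2) * Real.exp (-(2 * b * t))
        = b ^ (2 * k + 2) * (t ^ (2 * k + 1) * Real.exp (-(2 * b * t))) := fun t => by ring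
    simp only [this]
    rw [integral_const_mul, integral_pow_mul_exp_neg _ (by positivity : 0 < 2 * b), mul_pow]
    have h2 : b ^ (2 * k + 2) * ((2 * k + 1).factorial / (2 ^ (2 * k + 1 + 1) * b ^ (2 * k + 1 + 1)))
        = ((2 * k + 1).factorial : ℝ) / 2 ^ (2 * k + 2) := by
      field_simp
    rw [h2]
    exact div_le_self (by positivity) (one_le_pow₀ (by norm_num))

end LaplaceIntegrals

/-! ### Square functions and the bilinear multiplier estimate. -/

section Bilinear

variable {V : Type*} [NormedAddCommGroup V] [InnerProductSpace ℝ V] [FiniteDimensional ℝ V]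
  [MeasurableSpace V] [BorelSpace V]

theorem integrable_squareFunction (k : ℕ) {f : V → ℂ} (hf : MemLp f 2) :
    Integrable (fun p : V × ℝ => p.2 ^ (2 * k + 1) * ‖p.1‖ ^ (2 * k + 2)
      * Real.exp (-(2 * ‖p.1‖ * p.2)) * ‖f p.1‖ ^ 2)
      (volume.prod (volume.restrict (Set.Ioi (0 : ℝ)))) := by
  have hfi : Integrable (fun x => ‖f x‖ ^ 2) := hf.integrable_norm_pow (by norm_num)
  have hm : AEStronglyMeasurable (fun p : V × ℝ => p.2 ^ (2 * k + 1) * ‖p.1‖ ^ (2 * k + 2)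
      * Real.exp (-(2 * ‖p.1‖ * p.2)) * ‖f p.1‖ ^ 2)
      (volume.prod (volume.restrict (Set.Ioi (0 : ℝ)))) := by
    refine (Continuous.aestronglyMeasurable (by fun_prop)).mul ?_
    exact (hf.aestronglyMeasurable.comp_fst).norm.pow 2
  rw [integrable_prod_iff hm]
  constructor
  · exact Filter.Eventually.of_forall fun x =>
      (integrableOn_squareWeight k (norm_nonneg x)).mul_const (‖f x‖ ^ 2)
  · refine (hfi.const_mul ((2 * k + 1).factorial : ℝ)).mono' hm.norm.integral_prod_right'
      (Filter.Eventually.of_forall fun x => ?_)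
    rw [Real.norm_of_nonneg (by positivity)]
    have : ∀ t ∈ Set.Ioi (0 : ℝ), ‖t ^ (2 * k + 1) * ‖x‖ ^ (2 * k + 2)
      * Real.exp (-(2 * ‖x‖ * t)) * ‖f x‖ ^ 2‖ = t ^ (2 * k + 1) * ‖x‖ ^ (2 * k + 2)
      * Real.exp (-(2 * ‖x‖ * t)) * ‖f x‖ ^ 2 := fun t ht => by
        have : (0 : ℝ) < t := ht
        exact Real.norm_of_nonneg (by positivity)
    simp only
    rw [setIntegral_congr_fun measurableSet_Ioi this, integral_mul_const]
    gcongr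
    exact integral_squareWeight_le k (norm_nonneg x)

theorem integral_squareFunction_le (k : ℕ) {f : V → ℂ} (hf : MemLp f 2) :
    ∫ t in Set.Ioi (0 : ℝ), ∫ x, t ^ (2 * k + 1) * ‖x‖ ^ (2 * k + 2)
      * Real.exp (-(2 * ‖x‖ * t)) * ‖f x‖ ^ 2 ≤ (2 * k + 1).factorial * ∫ x, ‖f x‖ ^ 2 := by
  have hfi : Integrable (fun x => ‖f x‖ ^ 2) := hf.integrable_norm_pow (by norm_num)
  have hI := integrable_squareFunction k hf
  rw [← integral_integral_swap hI, ← integral_const_mul]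
  refine integral_mono hI.integral_prod_left (hfi.const_mul _) fun x => ?_
  simp only
  rw [integral_mul_const]
  gcongr
  exact integral_squareWeight_le k (norm_nonneg x)

theorem pow_mul_exp_neg_le (n : ℕ) {b t : ℝ} (hb : 0 ≤ b) (ht : 0 < t) :
    b ^ n * Real.exp (-(b * t)) ≤ n.factorial / t ^ n := by
  have h := Real.pow_div_factorial_le_exp (b * t) (by positivity) n
  rw [Real.exp_neg, ← div_eq_mul_inv, div_le_div_iff₀ (Real.exp_pos _) (by positivity)]
  rw [div_le_iff₀ (by positivity), mul_pow] at h
  linarith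

/-- The exponential factors over the three frequencies: its `ζ` part turns `α` into a Poisson
extension, its `η` part goes to `β` with `‖η‖^(k+1)`, and the rest goes to `γ` with `‖ζ+η‖`. -/
theorem norm_integral_poissonWeight_le (k : ℕ) {α β γ : V → ℂ} (hα : Integrable α) {M : ℝ}
    (hM : 0 < M) {t : ℝ} (ht : 0 < t)
    (hαM : ∀ x, ‖𝓕⁻ (fun ξ => (Real.exp (-(‖ξ‖ * t)) : ℂ) * α ξ) x‖ ≤ M)
    (hβ : Integrable β) (hβ2 : MemLp β 2) (hγ : Integrable γ) (hγm : Measurable γ) {B : ℝ}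
    (hB : ∀ x, ‖γ x‖ ≤ B) {l : ℝ} (hl : 0 < l) :
    ‖∫ p : V × V, ((t ^ (k + 1) * (‖p.2‖ ^ (k + 1) * ‖p.1 + p.2‖
        * Real.exp (-((‖p.1‖ + ‖p.2‖ + ‖p.1 + p.2‖) * t))) : ℝ) : ℂ)
        * (α p.1 * β p.2 * γ (p.1 + p.2)) ∂(volume.prod volume)‖ ≤
      M * l * (∫ x, t ^ (2 * k + 1) * ‖x‖ ^ (2 * k + 2) * Real.exp (-(2 * ‖x‖ * t)) * ‖β x‖ ^ 2)
      + M * l⁻¹ * (∫ x, t ^ (2 * 0 + 1) * ‖x‖ ^ (2 * 0 + 2)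
        * Real.exp (-(2 * ‖x‖ * t)) * ‖γ x‖ ^ 2) := by
  set w : ℕ → V → ℝ := fun n x => ‖x‖ ^ n * Real.exp (-(‖x‖ * t)) with hw
  have hw0 : ∀ n x, 0 ≤ w n x := fun n x => by simp only [hw]; positivity
  have hwc : ∀ n, Continuous fun x => (w n x : ℂ) := fun n => by simp only [hw]; fun_prop
  have hwb : ∀ n x, ‖(w n x : ℂ)‖ ≤ n.factorial / t ^ n := fun n x => by
    rw [Complex.norm_real, Real.norm_of_nonneg (hw0 n x)]
    exact pow_mul_exp_neg_le n (norm_nonneg x) ht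
  have hint : ∀ n {f : V → ℂ}, Integrable f → Integrable fun x => (w n x : ℂ) * f x :=
    fun n f hf => hf.bdd_mul (hwc n).aestronglyMeasurable (Filter.Eventually.of_forall (hwb n))
  have hL2 : MemLp (fun x => (w (k + 1) x : ℂ) * β x) 2 := by
    refine MemLp.of_le_mul (c := (k + 1).factorial / t ^ (k + 1)) hβ2
      ((hwc _).aestronglyMeasurable.mul hβ2.aestronglyMeasurable)
      (Filter.Eventually.of_forall fun x => ?_)
    rw [norm_mul]
    exact mul_le_mul_of_nonneg_right (hwb _ x) (norm_nonneg _)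
  have hαi : Integrable fun ξ => (Real.exp (-(‖ξ‖ * t)) : ℂ) * α ξ := by
    have := hint 0 hα
    simpa [hw] using this
  have key := two_mul_norm_integral_mul_mul_comp_add_le hαi hM hαM (hint (k + 1) hβ) hL2
    (hint 1 hγ) ((hwc 1).measurable.mul hγm) (B := (Nat.factorial 1) / t ^ 1 * B)
    (fun x => by
      rw [norm_mul]
      exact mul_le_mul (hwb 1 x) (hB x) (norm_nonneg _) (by positivity))
    -- The Young weight is `l * t ^ k`: after multiplication by `t ^ (k+1)` the two terms carry `t ^
    -- (2k+1)` and `t`, the weights of the square functions of orders `k` and `0`.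
    (mul_pos hl (pow_pos ht k))
  have e : ∀ p : V × V, ((t ^ (k + 1) * (‖p.2‖ ^ (k + 1) * ‖p.1 + p.2‖
        * Real.exp (-((‖p.1‖ + ‖p.2‖ + ‖p.1 + p.2‖) * t))) : ℝ) : ℂ)
        * (α p.1 * β p.2 * γ (p.1 + p.2))
      = (t ^ (k + 1) : ℝ) * ((Real.exp (-(‖p.1‖ * t)) : ℂ) * α p.1 * ((w (k + 1) p.2 : ℂ) * β p.2)
        * ((w 1 (p.1 + p.2) : ℂ) * γ (p.1 + p.2))) := by
    intro p
    have : Real.exp (-((‖p.1‖ + ‖p.2‖ + ‖p.1 + p.2‖) * t)) = Real.exp (-(‖p.1‖ * t))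
        * Real.exp (-(‖p.2‖ * t)) * Real.exp (-(‖p.1 + p.2‖ * t)) := by
      rw [← Real.exp_add, ← Real.exp_add]; congr 1; ring
    rw [this]
    simp only [hw]
    push_cast
    ring
  have hsq : ∀ n {f : V → ℂ} x, ‖(w n x : ℂ) * f x‖ ^ 2
      = ‖x‖ ^ (2 * n) * Real.exp (-(2 * ‖x‖ * t)) * ‖f x‖ ^ 2 := by
    intro n f x
    have : Real.exp (-(2 * ‖x‖ * t)) = Real.exp (-(‖x‖ * t)) ^ 2 := by
      rw [← Real.exp_nat_mul]; congr 1; push_cast; ring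
    rw [norm_mul, Complex.norm_real, Real.norm_of_nonneg (hw0 n x), this]
    simp only [hw]
    ring
  simp only [e]
  rw [integral_const_mul, norm_mul, Complex.norm_real, Real.norm_of_nonneg (by positivity)]
  simp only [hsq] at key
  have h1 : ∫ x, t ^ (2 * k + 1) * ‖x‖ ^ (2 * k + 2) * Real.exp (-(2 * ‖x‖ * t)) * ‖β x‖ ^ 2
      = t ^ (2 * k + 1) * ∫ x, ‖x‖ ^ (2 * (k + 1)) * Real.exp (-(2 * ‖x‖ * t)) * ‖β x‖ ^ 2 := by
    rw [← integral_const_mul]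
    refine integral_congr_ae (Filter.Eventually.of_forall fun x => ?_)
    simp only; ring
  have h2 : ∫ x, t ^ (2 * 0 + 1) * ‖x‖ ^ (2 * 0 + 2) * Real.exp (-(2 * ‖x‖ * t)) * ‖γ x‖ ^ 2
      = t * ∫ x, ‖x‖ ^ (2 * 1) * Real.exp (-(2 * ‖x‖ * t)) * ‖γ x‖ ^ 2 := by
    rw [← integral_const_mul]
    refine integral_congr_ae (Filter.Eventually.of_forall fun x => ?_)
    simp only; ring
  rw [h1, h2]
  set X := ∫ x, ‖x‖ ^ (2 * (k + 1)) * Real.exp (-(2 * ‖x‖ * t)) * ‖β x‖ ^ 2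
  set Y := ∫ x, ‖x‖ ^ (2 * 1) * Real.exp (-(2 * ‖x‖ * t)) * ‖γ x‖ ^ 2
  set T := ‖∫ p : V × V, (Real.exp (-(‖p.1‖ * t)) : ℂ) * α p.1 * ((w (k + 1) p.2 : ℂ) * β p.2)
        * ((w 1 (p.1 + p.2) : ℂ) * γ (p.1 + p.2)) ∂(volume.prod volume)‖
  have hT : 0 ≤ T := norm_nonneg _
  have h3 := mul_le_mul_of_nonneg_left key (pow_pos ht (k + 1)).le
  have h4 : t ^ (k + 1) * (M * (l * t ^ k * X) + M * ((l * t ^ k)⁻¹ * Y))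
      = M * l * (t ^ (2 * k + 1) * X) + M * l⁻¹ * (t * Y) := by
    field_simp
    ring
  have h5 : 0 ≤ t ^ (k + 1) * T := by positivity
  linarith

/-- A bilinear Fourier multiplier estimate: with `b = ‖η‖`, `c = ‖ζ + η‖` and
`S = ‖ζ‖ + ‖η‖ + ‖ζ + η‖`, the symbol `b ^ (k + 1) * c / S ^ (k + 2)` maps
`L^∞ × L²` to `L²`, where the first factor is measured through its Poisson extension. -/
theorem norm_integral_bilinearSymbol_le (k : ℕ) {α β γ : V → ℂ} (hα : Integrable α) {M : ℝ}
    (hM : 0 < M)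
    (hαM : ∀ t : ℝ, 0 < t → ∀ x, ‖𝓕⁻ (fun ξ => (Real.exp (-(‖ξ‖ * t)) : ℂ) * α ξ) x‖ ≤ M)
    (hβ : Integrable β) (hβ2 : MemLp β 2) (hγ : Integrable γ) (hγm : Measurable γ) {B : ℝ}
    (hB : ∀ x, ‖γ x‖ ≤ B) {l : ℝ} (hl : 0 < l) :
    ‖∫ p : V × V, ((‖p.2‖ ^ (k + 1) * ‖p.1 + p.2‖ / (‖p.1‖ + ‖p.2‖ + ‖p.1 + p.2‖) ^ (k + 2) : ℝ) : ℂ)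
        * (α p.1 * β p.2 * γ (p.1 + p.2)) ∂(volume.prod volume)‖
      ≤ (2 * k + 1).factorial * M * (l * ∫ x, ‖β x‖ ^ 2) + M * (l⁻¹ * ∫ x, ‖γ x‖ ^ 2) := by
  have hγ2 := memLp_two_of_integrable_of_bounded hγ hB
  have hB0 : 0 ≤ B := (norm_nonneg _).trans (hB 0)
  -- Integrating `m` over `t > 0` gives `(k+1)!` times the symbol, since `∫ t^(k+1) exp(-St) =
  -- (k+1)! / S^(k+2)`.
  set m : ℝ → V × V → ℝ := fun t p => t ^ (k + 1) * (‖p.2‖ ^ (k + 1) * ‖p.1 + p.2‖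
    * Real.exp (-((‖p.1‖ + ‖p.2‖ + ‖p.1 + p.2‖) * t))) with hm
  have hmI : ∀ p : V × V, IntegrableOn (fun t => m t p) (Set.Ioi 0) ∧
      ∫ t in Set.Ioi (0 : ℝ), m t p = (k + 1).factorial *
        (‖p.2‖ ^ (k + 1) * ‖p.1 + p.2‖ / (‖p.1‖ + ‖p.2‖ + ‖p.1 + p.2‖) ^ (k + 2)) := by
    intro p
    rcases (norm_nonneg p.2).eq_or_lt with h0 | h0
    · simp [hm, ← h0]
    have hS : 0 < ‖p.1‖ + ‖p.2‖ + ‖p.1 + p.2‖ := by positivity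
    have e : (fun t => m t p) = fun t => (‖p.2‖ ^ (k + 1) * ‖p.1 + p.2‖)
        * (t ^ (k + 1) * Real.exp (-((‖p.1‖ + ‖p.2‖ + ‖p.1 + p.2‖) * t))) := by
      ext t; simp only [hm]; ring
    rw [e]
    refine ⟨(integrableOn_pow_mul_exp_neg _ hS).const_mul _, ?_⟩
    rw [integral_const_mul, integral_pow_mul_exp_neg _ hS]
    ring
  have hle : ∀ p : V × V,
      ‖p.2‖ ^ (k + 1) * ‖p.1 + p.2‖ / (‖p.1‖ + ‖p.2‖ + ‖p.1 + p.2‖) ^ (k + 2) ≤ 1 := by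
    intro p
    refine div_le_one_of_le₀ ?_ (by positivity)
    rw [pow_succ _ (k + 1)]
    gcongr <;> linarith [norm_nonneg p.1, norm_nonneg p.2, norm_nonneg (p.1 + p.2)]
  set G : V × V → ℂ := fun p => α p.1 * β p.2 * γ (p.1 + p.2) with hG
  have hGi : Integrable G (volume.prod volume) := integrable_mul_mul_comp_add hα hβ hγm hB
  have hFi : Integrable (fun q : (V × V) × ℝ => (m q.2 q.1 : ℂ) * G q.1)
      ((volume.prod volume).prod (volume.restrict (Set.Ioi (0 : ℝ)))) := by
    have hmeas : AEStronglyMeasurable (fun q : (V × V) × ℝ => (m q.2 q.1 : ℂ) * G q.1)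
        ((volume.prod volume).prod (volume.restrict (Set.Ioi (0 : ℝ)))) := by
      refine (Continuous.aestronglyMeasurable ?_).mul hGi.aestronglyMeasurable.comp_fst
      simp only [hm]
      fun_prop
    rw [integrable_prod_iff hmeas]
    constructor
    · exact Filter.Eventually.of_forall fun p => (hmI p).1.ofReal.mul_const (G p)
    · refine (hGi.norm.const_mul ((k + 1).factorial : ℝ)).mono' hmeas.norm.integral_prod_right'
        (Filter.Eventually.of_forall fun p => ?_)
      rw [Real.norm_of_nonneg (by positivity)]
      have : ∀ t ∈ Set.Ioi (0 : ℝ), ‖(m t p : ℂ) * G p‖ = m t p * ‖G p‖ := fun t ht => by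
        have : (0 : ℝ) < t := ht
        rw [norm_mul, Complex.norm_real, Real.norm_of_nonneg (by simp only [hm]; positivity)]
      simp only
      rw [setIntegral_congr_fun measurableSet_Ioi this, integral_mul_const, (hmI p).2]
      exact mul_le_mul_of_nonneg_right (mul_le_of_le_one_right (by positivity) (hle p))
        (norm_nonneg _)
  have hswap : ((k + 1).factorial : ℂ) * ∫ p : V × V,
      ((‖p.2‖ ^ (k + 1) * ‖p.1 + p.2‖ / (‖p.1‖ + ‖p.2‖ + ‖p.1 + p.2‖) ^ (k + 2) : ℝ) : ℂ) * G p
        ∂(volume.prod volume)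
      = ∫ t in Set.Ioi (0 : ℝ), ∫ p, (m t p : ℂ) * G p ∂(volume.prod volume) := by
    rw [← integral_integral_swap hFi, ← integral_const_mul]
    refine integral_congr_ae (Filter.Eventually.of_forall fun p => ?_)
    simp only
    rw [integral_mul_const, integral_complex_ofReal, (hmI p).2]
    push_cast
    ring
  have hpt : ∀ t ∈ Set.Ioi (0 : ℝ), ‖∫ p, (m t p : ℂ) * G p ∂(volume.prod volume)‖ ≤
      M * l * (∫ x, t ^ (2 * k + 1) * ‖x‖ ^ (2 * k + 2) * Real.exp (-(2 * ‖x‖ * t)) * ‖β x‖ ^ 2)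
      + M * l⁻¹ * (∫ x, t ^ (2 * 0 + 1) * ‖x‖ ^ (2 * 0 + 2)
        * Real.exp (-(2 * ‖x‖ * t)) * ‖γ x‖ ^ 2) := by
    intro t ht
    exact norm_integral_poissonWeight_le k hα hM ht (hαM t ht) hβ hβ2 hγ hγm hB hl
  have hIβ := integrable_squareFunction k hβ2
  have hIγ := integrable_squareFunction 0 hγ2
  have hfin : ‖∫ t in Set.Ioi (0 : ℝ), ∫ p, (m t p : ℂ) * G p ∂(volume.prod volume)‖
      ≤ M * l * ((2 * k + 1).factorial * ∫ x, ‖β x‖ ^ 2)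
        + M * l⁻¹ * ((2 * 0 + 1).factorial * ∫ x, ‖γ x‖ ^ 2) := by
    refine (norm_integral_le_of_norm_le ((hIβ.integral_prod_right.const_mul (M * l)).add
      (hIγ.integral_prod_right.const_mul (M * l⁻¹)))
      ((ae_restrict_mem measurableSet_Ioi).mono hpt)).trans ?_
    simp only [Pi.add_apply]
    rw [integral_add (hIβ.integral_prod_right.const_mul (M * l))
      (hIγ.integral_prod_right.const_mul (M * l⁻¹)), integral_const_mul, integral_const_mul]
    gcongr
    · exact integral_squareFunction_le k hβ2
    · exact integral_squareFunction_le 0 hγ2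
  rw [← hswap, norm_mul] at hfin
  -- The gain of `1/(k+1)!` is discarded.
  have h1 : (1 : ℝ) ≤ ‖((k + 1).factorial : ℂ)‖ := by
    rw [Complex.norm_natCast]
    exact_mod_cast Nat.one_le_iff_ne_zero.2 (Nat.factorial_ne_zero _)
  refine (le_mul_of_one_le_left (norm_nonneg _) h1).trans (hfin.trans (le_of_eq ?_))
  simp
  ring

end Bilinear

/-! ### Subordination of the Poisson kernel to Gaussians. -/

section Subordination

/-- The Cauchy–Schlömilch substitution for the Gaussian. -/
theorem integral_exp_neg_sub_div_sq {b : ℝ} (hb : 0 < b) :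
    ∫ x in Set.Ioi (0 : ℝ), Real.exp (-(x - b / x) ^ 2) = Real.sqrt Real.pi / 2 := by
  have hd1 : ∀ x ∈ Set.Ioi (0 : ℝ),
      HasDerivWithinAt (fun x => b / x) (-(b / x ^ 2)) (Set.Ioi 0) x := by
    intro x hx
    have hx' : x ≠ 0 := ne_of_gt hx
    have := ((hasDerivAt_inv hx').const_mul b).hasDerivWithinAt (s := Set.Ioi 0)
    refine (this.congr_deriv (by field_simp)).congr (fun y _ => by ring) (by ring)
  have hd2 : ∀ x ∈ Set.Ioi (0 : ℝ),
      HasDerivWithinAt (fun x => x - b / x) (1 + b / x ^ 2) (Set.Ioi 0) x := by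
    intro x hx
    exact ((hasDerivWithinAt_id x _).sub (hd1 x hx)).congr_deriv (by ring)
  have hi1 : (fun x => b / x) '' Set.Ioi (0 : ℝ) = Set.Ioi 0 := by
    ext y
    constructor
    · rintro ⟨x, hx, rfl⟩
      exact div_pos hb hx
    · intro hy
      exact ⟨b / y, div_pos hb hy, by have : y ≠ 0 := ne_of_gt hy; field_simp⟩
  have hi2 : (fun x => x - b / x) '' Set.Ioi (0 : ℝ) = Set.univ := by
    refine Set.eq_univ_of_forall fun y => ?_
    have h1 : |y| < Real.sqrt (y ^ 2 + 4 * b) := by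
      rw [← Real.sqrt_sq_eq_abs]
      exact Real.sqrt_lt_sqrt (sq_nonneg y) (by linarith)
    have h2 : 0 < y + Real.sqrt (y ^ 2 + 4 * b) := by linarith [neg_abs_le y]
    have h3 : Real.sqrt (y ^ 2 + 4 * b) ^ 2 = y ^ 2 + 4 * b := Real.sq_sqrt (by positivity)
    refine ⟨(y + Real.sqrt (y ^ 2 + 4 * b)) / 2, by simpa using h2, ?_⟩
    simp only
    field_simp
    nlinarith
  have hn1 : Set.InjOn (fun x => b / x) (Set.Ioi (0 : ℝ)) := by
    intro x hx y hy hxy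
    have hx' : x ≠ 0 := ne_of_gt hx
    have hy' : y ≠ 0 := ne_of_gt hy
    simp only at hxy
    field_simp at hxy
    exact hxy.symm
  have hn2 : Set.InjOn (fun x => x - b / x) (Set.Ioi (0 : ℝ)) := by
    refine StrictMonoOn.injOn fun x hx y hy hxy => ?_
    have : b / y ≤ b / x := div_le_div_of_nonneg_left hb.le hx hxy.le
    linarith
  have e1 := integral_image_eq_integral_abs_deriv_smul measurableSet_Ioi hd1 hn1
    (fun x => Real.exp (-(x - b / x) ^ 2))
  have e2 := integral_image_eq_integral_abs_deriv_smul measurableSet_Ioi hd2 hn2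
    (fun x => Real.exp (-x ^ 2))
  have hG : ∫ x : ℝ, Real.exp (-x ^ 2) = Real.sqrt Real.pi := by
    simpa using integral_gaussian 1
  rw [hi1] at e1
  rw [hi2, setIntegral_univ, hG] at e2
  -- The substitution `x ↦ b / x` only changes the sign of `x - b / x`.
  have e1' : ∫ x in Set.Ioi (0 : ℝ), Real.exp (-(x - b / x) ^ 2)
      = ∫ x in Set.Ioi (0 : ℝ), b / x ^ 2 * Real.exp (-(x - b / x) ^ 2) := by
    refine e1.trans (setIntegral_congr_fun measurableSet_Ioi fun x hx => ?_)
    have hx' : (0 : ℝ) < x := hx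
    simp only [smul_eq_mul]
    rw [abs_neg, abs_of_pos (by positivity)]
    congr 2
    field_simp
    ring
  -- The map `x ↦ x - b / x` carries the half-line bijectively onto `ℝ`, giving the full Gaussian
  -- integral; by `e1'` its two summands are equal, hence the half.
  have e2' : Real.sqrt Real.pi
      = ∫ x in Set.Ioi (0 : ℝ), (1 + b / x ^ 2) * Real.exp (-(x - b / x) ^ 2) := by
    refine e2.trans (setIntegral_congr_fun measurableSet_Ioi fun x hx => ?_)
    have hx' : (0 : ℝ) < x := hx
    simp only [smul_eq_mul]
    rw [abs_of_pos (by positivity)]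
  have hint : IntegrableOn (fun x => (1 + b / x ^ 2) * Real.exp (-(x - b / x) ^ 2))
      (Set.Ioi (0 : ℝ)) := by
    by_contra h
    rw [integral_undef h] at e2'
    exact (Real.sqrt_pos.2 Real.pi_pos).ne' e2'
  have hint1 : IntegrableOn (fun x => Real.exp (-(x - b / x) ^ 2)) (Set.Ioi (0 : ℝ)) := by
    refine Integrable.mono' hint (Measurable.aestronglyMeasurable (by fun_prop))
      ((ae_restrict_mem measurableSet_Ioi).mono fun x hx => ?_)
    have hx' : (0 : ℝ) < x := hx
    rw [Real.norm_of_nonneg (Real.exp_pos _).le]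
    refine le_mul_of_one_le_left (Real.exp_pos _).le ?_
    have : 0 < b / x ^ 2 := by positivity
    linarith
  have hint2 : IntegrableOn (fun x => b / x ^ 2 * Real.exp (-(x - b / x) ^ 2))
      (Set.Ioi (0 : ℝ)) := by
    refine (hint.sub hint1).congr (Filter.Eventually.of_forall fun x => ?_)
    simp only [Pi.sub_apply]; ring
  have e3 : ∫ x in Set.Ioi (0 : ℝ), (1 + b / x ^ 2) * Real.exp (-(x - b / x) ^ 2)
      = (∫ x in Set.Ioi (0 : ℝ), Real.exp (-(x - b / x) ^ 2))
        + ∫ x in Set.Ioi (0 : ℝ), b / x ^ 2 * Real.exp (-(x - b / x) ^ 2) := by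
    rw [← integral_add hint1 hint2]
    congr 1; ext x; ring
  linarith

/-- Subordination of the Poisson semigroup to the heat semigroup. -/
theorem exp_neg_eq_integral_gaussian {r : ℝ} (hr : 0 ≤ r) :
    Real.exp (-r) = 2 / Real.sqrt Real.pi *
      ∫ y in Set.Ioi (0 : ℝ), Real.exp (-y ^ 2) * Real.exp (-(r ^ 2 / (4 * y ^ 2))) := by
  have hpi : 0 < Real.sqrt Real.pi := Real.sqrt_pos.2 Real.pi_pos
  rcases hr.eq_or_lt with rfl | hr
  · have := integral_gaussian_Ioi 1
    simp at this
    simp [this]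
    field_simp
  · have h := integral_exp_neg_sub_div_sq (b := r / 2) (by positivity)
    -- Completing the square: `y² + r²/(4y²) = (y - r/(2y))² + r`.
    have e : ∫ y in Set.Ioi (0 : ℝ), Real.exp (-y ^ 2) * Real.exp (-(r ^ 2 / (4 * y ^ 2)))
        = Real.exp (-r) * ∫ y in Set.Ioi (0 : ℝ), Real.exp (-(y - r / 2 / y) ^ 2) := by
      rw [← integral_const_mul]
      refine setIntegral_congr_fun measurableSet_Ioi fun y hy => ?_
      have hy' : (0 : ℝ) < y := hy
      rw [← Real.exp_add, ← Real.exp_add]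
      congr 1
      field_simp
      ring
    rw [e, h]
    field_simp

end Subordination

/-! ### Maximum principle for the heat and Poisson semigroups. -/

section Poisson

variable {V : Type*} [NormedAddCommGroup V] [InnerProductSpace ℝ V] [FiniteDimensional ℝ V]
  [MeasurableSpace V] [BorelSpace V]

/-- The heat semigroup is a contraction in the sup norm. -/
theorem norm_fourierInv_gaussian_mul_fourier_le (f : SchwartzMap V ℂ) {M : ℝ}
    (hf : ∀ x, ‖f x‖ ≤ M) {s : ℝ} (hs : 0 < s) (x : V) :
    ‖𝓕⁻ (fun ξ => (Real.exp (-(s * ‖ξ‖ ^ 2)) : ℂ) * 𝓕 (f : V → ℂ) ξ) x‖ ≤ M := by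
  set G : V → ℂ := fun v => Complex.exp (-(s : ℂ) * ‖v‖ ^ 2 + 2 * Real.pi * Complex.I * inner ℝ x v)
    with hG
  have hs' : 0 < (s : ℂ).re := by simpa using hs
  have hGi : Integrable G := by
    have := GaussianFourier.integrable_cexp_neg_mul_sq_norm_add hs' (2 * Real.pi * Complex.I) x
    simpa [hG] using this
  have e1 : 𝓕⁻ (fun ξ => (Real.exp (-(s * ‖ξ‖ ^ 2)) : ℂ) * 𝓕 (f : V → ℂ) ξ) x
      = ∫ ξ, 𝓕 (f : V → ℂ) ξ * G ξ := by
    rw [Real.fourierInv_eq']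
    refine integral_congr_ae (Filter.Eventually.of_forall fun ξ => ?_)
    simp only [hG, Complex.exp_add, smul_eq_mul, real_inner_comm]
    push_cast
    ring_nf
  have e2 : ∫ ξ, 𝓕 (f : V → ℂ) ξ * G ξ = ∫ w, f w * 𝓕 G w := by
    have h := VectorFourier.integral_fourierIntegral_smul_eq_flip (L := innerₗ V)
      (μ := volume) (ν := volume) (f := (f : V → ℂ)) (g := G)
      Real.continuous_fourierChar continuous_inner f.integrable hGi
    rw [flip_innerₗ] at h
    exact h
  -- The modulus of `𝓕 G` is the heat kernel centred at `x`, of total mass one, so pairing it with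
  -- `f` cannot exceed `M`.
  have e3 : ∀ w, ‖𝓕 G w‖ = (Real.pi / s) ^ (Module.finrank ℝ V / 2 : ℝ)
      * Real.exp (-(Real.pi ^ 2 / s) * ‖w - x‖ ^ 2) := by
    intro w
    rw [hG, fourier_gaussian_innerProductSpace' hs' x w, norm_mul]
    congr 1
    · rw [← Complex.ofReal_div, show (Module.finrank ℝ V / 2 : ℂ)
        = ((Module.finrank ℝ V / 2 : ℝ) : ℂ) by push_cast; rfl,
        Complex.norm_cpow_eq_rpow_re_of_pos (by positivity), Complex.ofReal_re]
    · rw [show -(Real.pi : ℂ) ^ 2 * (‖x - w‖ : ℂ) ^ 2 / (s : ℂ)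
        = ((-(Real.pi ^ 2 / s) * ‖w - x‖ ^ 2 : ℝ) : ℂ) by
          rw [norm_sub_rev]; push_cast; ring, ← Complex.ofReal_exp, Complex.norm_real,
          Real.norm_of_nonneg (Real.exp_pos _).le]
  have hb : 0 < Real.pi ^ 2 / s := by positivity
  have hgi : Integrable fun w : V => Real.exp (-(Real.pi ^ 2 / s) * ‖w‖ ^ 2) := by
    by_contra h
    have h1 := GaussianFourier.integral_rexp_neg_mul_sq_norm (V := V) hb
    rw [integral_undef h] at h1
    have : 0 < (Real.pi / (Real.pi ^ 2 / s)) ^ (Module.finrank ℝ V / 2 : ℝ) := by positivity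
    exact this.ne h1
  have hgi' : Integrable fun w : V => (Real.pi / s) ^ (Module.finrank ℝ V / 2 : ℝ)
      * Real.exp (-(Real.pi ^ 2 / s) * ‖w - x‖ ^ 2) :=
    (hgi.comp_sub_right x).const_mul _
  rw [e1, e2]
  refine (norm_integral_le_of_norm_le (hgi'.const_mul M)
    (Filter.Eventually.of_forall fun w => ?_)).trans (le_of_eq ?_)
  · rw [norm_mul, e3]
    exact mul_le_mul_of_nonneg_right (hf w) (by positivity)
  · rw [integral_const_mul, integral_const_mul,
      integral_sub_right_eq_self (fun w : V => Real.exp (-(Real.pi ^ 2 / s) * ‖w‖ ^ 2)),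
      GaussianFourier.integral_rexp_neg_mul_sq_norm hb, ← Real.mul_rpow (by positivity)
        (by positivity)]
    have : Real.pi / s * (Real.pi / (Real.pi ^ 2 / s)) = 1 := by field_simp
    rw [this, Real.one_rpow, mul_one]

/-- The Poisson semigroup is a contraction in the sup norm. -/
theorem norm_fourierInv_poisson_mul_fourier_le (f : SchwartzMap V ℂ) {M : ℝ}
    (hf : ∀ x, ‖f x‖ ≤ M) {t : ℝ} (ht : 0 < t) (x : V) :
    ‖𝓕⁻ (fun ξ => (Real.exp (-(‖ξ‖ * t)) : ℂ) * 𝓕 (f : V → ℂ) ξ) x‖ ≤ M := by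
  have hpi : 0 < Real.sqrt Real.pi := Real.sqrt_pos.2 Real.pi_pos
  have hfi : Integrable (𝓕 (f : V → ℂ)) := by
    rw [← SchwartzMap.fourier_coe]; exact SchwartzMap.integrable _
  set e : V → ℂ := fun ξ => Complex.exp (2 * Real.pi * inner ℝ ξ x * Complex.I) with he
  have hen : ∀ ξ, ‖e ξ‖ = 1 := fun ξ => by
    simp only [he]
    rw [show (2 * Real.pi * inner ℝ ξ x * Complex.I : ℂ)
      = ((2 * Real.pi * inner ℝ ξ x : ℝ) : ℂ) * Complex.I by push_cast; ring]
    exact Complex.norm_exp_ofReal_mul_I _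
  have hec : Continuous e := by simp only [he]; fun_prop
  -- For each `y` the `ξ`-integral is a heat evolution at time parameter `t²/(4y²)`, bounded by `M`;
  -- the Poisson evolution is an average of these against a weight of mass one.
  set K : V → ℝ → ℂ := fun ξ y => (Real.exp (-y ^ 2) : ℂ)
    * ((Real.exp (-(t ^ 2 / (4 * y ^ 2) * ‖ξ‖ ^ 2)) : ℂ) * (e ξ * 𝓕 (f : V → ℂ) ξ)) with hK
  have hgauss : Integrable (fun y : ℝ => Real.exp (-y ^ 2)) (volume.restrict (Set.Ioi 0)) := by
    have := (integrable_exp_neg_mul_sq (b := 1) one_pos).restrict (s := Set.Ioi 0)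
    simpa using this
  have hKi : Integrable (Function.uncurry K) (volume.prod (volume.restrict (Set.Ioi (0 : ℝ)))) := by
    refine Integrable.mono' (hfi.norm.mul_prod hgauss) ?_ (Filter.Eventually.of_forall fun p => ?_)
    · simp only [hK, Function.uncurry_def]
      refine AEStronglyMeasurable.mul (Measurable.aestronglyMeasurable (by fun_prop)) ?_
      refine AEStronglyMeasurable.mul (Measurable.aestronglyMeasurable (by fun_prop)) ?_
      exact (hec.aestronglyMeasurable.mul hfi.aestronglyMeasurable).comp_fst
    · simp only [hK, Function.uncurry_def, norm_mul, hen, one_mul, Complex.norm_real,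
        Real.norm_of_nonneg (Real.exp_pos _).le]
      rw [mul_comm]
      refine mul_le_mul_of_nonneg_right ?_ (Real.exp_pos _).le
      refine mul_le_of_le_one_left (norm_nonneg _) (Real.exp_le_one_iff.2 ?_)
      rw [neg_nonpos]
      positivity
  have e1 : 𝓕⁻ (fun ξ => (Real.exp (-(‖ξ‖ * t)) : ℂ) * 𝓕 (f : V → ℂ) ξ) x
      = ((2 / Real.sqrt Real.pi : ℝ) : ℂ) * ∫ ξ, ∫ y in Set.Ioi (0 : ℝ), K ξ y := by
    rw [Real.fourierInv_eq', ← integral_const_mul]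
    refine integral_congr_ae (Filter.Eventually.of_forall fun ξ => ?_)
    simp only [hK]
    have h2 : ∀ y : ℝ, (Real.exp (-y ^ 2) : ℂ)
        * ((Real.exp (-(t ^ 2 / (4 * y ^ 2) * ‖ξ‖ ^ 2)) : ℂ) * (e ξ * 𝓕 (f : V → ℂ) ξ))
        = ((Real.exp (-y ^ 2) * Real.exp (-((‖ξ‖ * t) ^ 2 / (4 * y ^ 2))) : ℝ) : ℂ)
          * (e ξ * 𝓕 (f : V → ℂ) ξ) := by
      intro y
      rw [show t ^ 2 / (4 * y ^ 2) * ‖ξ‖ ^ 2 = (‖ξ‖ * t) ^ 2 / (4 * y ^ 2) by ring]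
      push_cast
      ring
    simp only [h2]
    rw [integral_mul_const, integral_complex_ofReal,
      exp_neg_eq_integral_gaussian (by positivity : 0 ≤ ‖ξ‖ * t)]
    simp only [he, smul_eq_mul]
    push_cast
    ring
  have e2 : ∀ y ∈ Set.Ioi (0 : ℝ), ‖∫ ξ, K ξ y‖ ≤ M * Real.exp (-y ^ 2) := by
    intro y hy
    have hy' : (0 : ℝ) < y := hy
    have h3 := norm_fourierInv_gaussian_mul_fourier_le f hf
      (s := t ^ 2 / (4 * y ^ 2)) (by positivity) x
    rw [Real.fourierInv_eq'] at h3
    have h4 : ∫ ξ, K ξ y = (Real.exp (-y ^ 2) : ℂ) *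
        ∫ v, Complex.exp (((2 * Real.pi * inner ℝ v x : ℝ) : ℂ) * Complex.I)
          • ((Real.exp (-(t ^ 2 / (4 * y ^ 2) * ‖v‖ ^ 2)) : ℂ) * 𝓕 (f : V → ℂ) v) := by
      rw [← integral_const_mul]
      refine integral_congr_ae (Filter.Eventually.of_forall fun ξ => ?_)
      simp only [hK, he, smul_eq_mul]
      push_cast
      ring
    rw [h4, norm_mul, Complex.norm_real, Real.norm_of_nonneg (Real.exp_pos _).le, mul_comm]
    exact mul_le_mul_of_nonneg_right h3 (Real.exp_pos _).le
  rw [e1, integral_integral_swap hKi, norm_mul, Complex.norm_real,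
    Real.norm_of_nonneg (by positivity)]
  have h5 := norm_integral_le_of_norm_le (hgauss.const_mul M)
    ((ae_restrict_mem measurableSet_Ioi).mono e2)
  have h6 : ∫ y in Set.Ioi (0 : ℝ), Real.exp (-y ^ 2) = Real.sqrt Real.pi / 2 := by
    simpa using integral_gaussian_Ioi 1
  rw [integral_const_mul, h6] at h5
  calc _ ≤ 2 / Real.sqrt Real.pi * (M * (Real.sqrt Real.pi / 2)) := by gcongr
    _ = M := by field_simp

end Poisson

/-! ### Bookkeeping for finite sums of bounded integrals. -/

section IntegralBound

variable {X : Type*} [MeasurableSpace X] {μ : Measure X}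

/-- `f` is integrable and its integral has norm at most `K`. -/
def IntegralBound (μ : Measure X) (f : X → ℂ) (K : ℝ) : Prop :=
  Integrable f μ ∧ ‖∫ x, f x ∂μ‖ ≤ K

theorem IntegralBound.add {f g : X → ℂ} {K L : ℝ} (hf : IntegralBound μ f K)
    (hg : IntegralBound μ g L) : IntegralBound μ (fun x => f x + g x) (K + L) := by
  refine ⟨hf.1.add hg.1, ?_⟩
  rw [integral_add hf.1 hg.1]
  exact (norm_add_le _ _).trans (add_le_add hf.2 hg.2)

theorem IntegralBound.const_mul {f : X → ℂ} {K : ℝ} (hf : IntegralBound μ f K) (c : ℂ) :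
    IntegralBound μ (fun x => c * f x) (‖c‖ * K) := by
  refine ⟨hf.1.const_mul c, ?_⟩
  rw [integral_const_mul, norm_mul]
  exact mul_le_mul_of_nonneg_left hf.2 (norm_nonneg _)

theorem IntegralBound.sum {ι : Type*} [Fintype ι] {f : ι → X → ℂ} {K : ℝ}
    (hf : ∀ i, IntegralBound μ (f i) K) :
    IntegralBound μ (fun x => ∑ i, f i x) (Fintype.card ι * K) := by
  refine ⟨integrable_finsetSum _ fun i _ => (hf i).1, ?_⟩
  rw [integral_finsetSum _ fun i _ => (hf i).1]
  refine (norm_sum_le _ _).trans ((Finset.sum_le_sum fun i _ => (hf i).2).trans (le_of_eq ?_))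
  simp

theorem IntegralBound.mono {f : X → ℂ} {K L : ℝ} (hf : IntegralBound μ f K) (h : K ≤ L) :
    IntegralBound μ f L := ⟨hf.1, hf.2.trans h⟩

end IntegralBound

/-! ### The multiplier estimate in a form that adds up. -/

section Bilinear

variable {V : Type*} [NormedAddCommGroup V] [InnerProductSpace ℝ V] [FiniteDimensional ℝ V]
  [MeasurableSpace V] [BorelSpace V]

/-- The function `α` has Poisson extension bounded by `M`. -/
def PoissonBounded (α : V → ℂ) (M : ℝ) : Prop :=
  Integrable α ∧
    ∀ t : ℝ, 0 < t → ∀ x, ‖𝓕⁻ (fun ξ => (Real.exp (-(‖ξ‖ * t)) : ℂ) * α ξ) x‖ ≤ M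

/-- Integrable, square integrable, and with squared `L²` norm at most `K`. -/
def SquareBounded (β : V → ℂ) (K : ℝ) : Prop :=
  Integrable β ∧ MemLp β 2 ∧ ∫ x, ‖β x‖ ^ 2 ≤ K

/-- A bounded integrable function with squared `L²` norm at most `K`. -/
def TestBounded (γ : V → ℂ) (K : ℝ) : Prop :=
  Integrable γ ∧ Measurable γ ∧ (∃ B, ∀ x, ‖γ x‖ ≤ B) ∧ ∫ x, ‖γ x‖ ^ 2 ≤ K

/-- The factorial is put on both terms, so that every bound is a multiple of the one quantity `M *
(l * P + l⁻¹ * Q)`. -/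
theorem bilinearSymbol_right (k : ℕ) {α β γ : V → ℂ} {M P Q l : ℝ} (hM : 0 < M) (hl : 0 < l)
    (hα : PoissonBounded α M) (hβ : SquareBounded β P) (hγ : TestBounded γ Q) :
    IntegralBound (volume.prod volume) (fun p : V × V =>
      ((‖p.2‖ ^ (k + 1) * ‖p.1 + p.2‖ / (‖p.1‖ + ‖p.2‖ + ‖p.1 + p.2‖) ^ (k + 2) : ℝ) : ℂ)
        * (α p.1 * β p.2 * γ (p.1 + p.2)))
      ((2 * k + 1).factorial * (M * (l * P + l⁻¹ * Q))) := by
  obtain ⟨hγ1, hγ2, ⟨B, hB⟩, hγ3⟩ := hγ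
  constructor
  · refine (integrable_mul_mul_comp_add hα.1 hβ.1 hγ2 hB).bdd_mul (c := 1)
      (Measurable.aestronglyMeasurable (by fun_prop)) (Filter.Eventually.of_forall fun p => ?_)
    rw [Complex.norm_real, Real.norm_of_nonneg (by positivity)]
    refine div_le_one_of_le₀ ?_ (by positivity)
    rw [pow_succ _ (k + 1)]
    gcongr <;> linarith [norm_nonneg p.1, norm_nonneg p.2, norm_nonneg (p.1 + p.2)]
  · refine (norm_integral_bilinearSymbol_le k hα.1 hM hα.2 hβ.1 hβ.2.1 hγ1 hγ2 hB hl).trans ?_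
    have h1 : (1 : ℝ) ≤ (2 * k + 1).factorial := by
      exact_mod_cast Nat.one_le_iff_ne_zero.2 (Nat.factorial_ne_zero _)
    have h2 : 0 ≤ M * (l⁻¹ * Q) := by
      have : 0 ≤ Q := le_trans (by positivity) hγ3
      positivity
    have h3 : M * (l⁻¹ * ∫ x, ‖γ x‖ ^ 2) ≤ M * (l⁻¹ * Q) := by gcongr
    have h4 : (2 * k + 1).factorial * M * (l * ∫ x, ‖β x‖ ^ 2)
        ≤ (2 * k + 1).factorial * M * (l * P) := by
      gcongr
      exact hβ.2.2
    nlinarith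

theorem bilinearSymbol_left (k : ℕ) {α β γ : V → ℂ} {M P Q l : ℝ} (hM : 0 < M) (hl : 0 < l)
    (hα : PoissonBounded α M) (hβ : SquareBounded β P) (hγ : TestBounded γ Q) :
    IntegralBound (volume.prod volume) (fun p : V × V =>
      ((‖p.1‖ ^ (k + 1) * ‖p.1 + p.2‖ / (‖p.1‖ + ‖p.2‖ + ‖p.1 + p.2‖) ^ (k + 2) : ℝ) : ℂ)
        * (β p.1 * α p.2 * γ (p.1 + p.2)))
      ((2 * k + 1).factorial * (M * (l * P + l⁻¹ * Q))) := by
  have h := bilinearSymbol_right k hM hl hα hβ hγ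
  have e : (fun p : V × V =>
      ((‖p.1‖ ^ (k + 1) * ‖p.1 + p.2‖ / (‖p.1‖ + ‖p.2‖ + ‖p.1 + p.2‖) ^ (k + 2) : ℝ) : ℂ)
        * (β p.1 * α p.2 * γ (p.1 + p.2)))
      = fun p => (fun p : V × V =>
      ((‖p.2‖ ^ (k + 1) * ‖p.1 + p.2‖ / (‖p.1‖ + ‖p.2‖ + ‖p.1 + p.2‖) ^ (k + 2) : ℝ) : ℂ)
        * (α p.1 * β p.2 * γ (p.1 + p.2))) p.swap := by
    ext p
    simp only [Prod.fst_swap, Prod.snd_swap]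
    rw [add_comm p.2 p.1, add_comm ‖p.2‖ ‖p.1‖, mul_comm (α p.2)]
  rw [e]
  refine ⟨h.1.swap, ?_⟩
  rw [integral_prod_swap]
  exact h.2

theorem SchwartzMap.norm_mul_norm_le {V : Type*} [NormedAddCommGroup V] [InnerProductSpace ℝ V]
    (U : SchwartzMap V ℂ) : ∃ C, ∀ x, ‖x‖ * ‖U x‖ ≤ C := by
  obtain ⟨C, hC⟩ := U.decay 1 0
  exact ⟨C, fun x => by simpa using hC.2 x⟩

/-- Serves for all the symbols of degree one that occur: `ξ_j`, `‖ξ‖` and `ξ_j ξ_i / ‖ξ‖`. -/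
theorem squareBounded_mul_schwartz (U : SchwartzMap V ℂ) {m : V → ℝ} (hm : Measurable m)
    (hmx : ∀ x, |m x| ≤ ‖x‖) :
    SquareBounded (fun x => (m x : ℂ) * U x) (∫ x, ‖x‖ ^ 2 * ‖U x‖ ^ 2) := by
  have hle : ∀ x, ‖(m x : ℂ) * U x‖ ≤ ‖x‖ * ‖U x‖ := fun x => by
    rw [norm_mul, Complex.norm_real]
    exact mul_le_mul_of_nonneg_right (hmx x) (norm_nonneg _)
  have hmeas : AEStronglyMeasurable (fun x => (m x : ℂ) * U x) volume :=
    (Complex.measurable_ofReal.comp hm).aestronglyMeasurable.mul U.continuous.aestronglyMeasurable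
  have hint : Integrable fun x => ‖x‖ * ‖U x‖ := by
    simpa using U.integrable_pow_mul volume 1
  obtain ⟨C, hC⟩ := U.norm_mul_norm_le
  have hi : Integrable (fun x => (m x : ℂ) * U x) :=
    hint.mono' hmeas (Filter.Eventually.of_forall hle)
  have h2 : MemLp (fun x => (m x : ℂ) * U x) 2 :=
    memLp_two_of_integrable_of_bounded hi fun x => (hle x).trans (hC x)
  refine ⟨hi, h2, integral_mono (h2.integrable_norm_pow (by norm_num)) ?_ fun x => ?_⟩
  · refine (hint.const_mul C).mono' (Continuous.aestronglyMeasurable (by fun_prop))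
      (Filter.Eventually.of_forall fun x => ?_)
    rw [Real.norm_of_nonneg (by positivity)]
    have := mul_le_mul_of_nonneg_right (hC x) (by positivity : 0 ≤ ‖x‖ * ‖U x‖)
    linarith [this, (by ring : ‖x‖ ^ 2 * ‖U x‖ ^ 2 = ‖x‖ * ‖U x‖ * (‖x‖ * ‖U x‖))]
  · simp only
    rw [← mul_pow]
    exact pow_le_pow_left₀ (norm_nonneg _) (hle x) 2

/-- Lets Riesz symbols `ξ_j / ‖ξ‖` be absorbed into the test function. -/
theorem TestBounded.mul {γ : V → ℂ} {Q : ℝ} (hγ : TestBounded γ Q) {m : V → ℝ}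
    (hm : Measurable m) (hmx : ∀ x, |m x| ≤ 1) :
    TestBounded (fun x => (m x : ℂ) * γ x) Q := by
  obtain ⟨hγ1, hγ2, ⟨B, hB⟩, hγ3⟩ := hγ
  have hle : ∀ x, ‖(m x : ℂ) * γ x‖ ≤ ‖γ x‖ := fun x => by
    rw [norm_mul, Complex.norm_real]
    exact mul_le_of_le_one_left (norm_nonneg _) (hmx x)
  have hmm : Measurable fun x => (m x : ℂ) * γ x := (Complex.measurable_ofReal.comp hm).mul hγ2
  have hi : Integrable fun x => (m x : ℂ) * γ x :=
    hγ1.mono hmm.aestronglyMeasurable (Filter.Eventually.of_forall hle)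
  have hB' : ∀ x, ‖(m x : ℂ) * γ x‖ ≤ B := fun x => (hle x).trans (hB x)
  refine ⟨hi, hmm, ⟨B, hB'⟩, le_trans ?_ hγ3⟩
  exact integral_mono ((memLp_two_of_integrable_of_bounded hi hB').integrable_norm_pow (by norm_num))
    ((memLp_two_of_integrable_of_bounded hγ1 hB).integrable_norm_pow (by norm_num))
    fun x => pow_le_pow_left₀ (norm_nonneg _) (hle x) 2

end Bilinear

/-! ### Decomposition of the commutator symbol. -/

section Commutator

/-- Here `p = ζ·η` and `q = ζ·(ζ+η)`, so `p + q = c² - b²`. The identity trades the denominator `b +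
c` of `(c² - b²)/(b + c)` for powers of `a + b + c`, whose Laplace integral has a decaying factor in
every frequency. -/
theorem sub_eq_commutatorSymbol {a b c p q : ℝ} (hS : 0 < a + b + c)
    (hp : 2 * p = c ^ 2 - a ^ 2 - b ^ 2) (hq : 2 * q = a ^ 2 + c ^ 2 - b ^ 2) :
    c - b = (4 * a * p + 2 * b * q + 2 * c * p) / (a + b + c) ^ 2
      + 4 * a ^ 2 * (a * c + q) / (a + b + c) ^ 3 := by
  have hp' : p = (c ^ 2 - a ^ 2 - b ^ 2) / 2 := by linarith
  have hq' : q = (a ^ 2 + c ^ 2 - b ^ 2) / 2 := by linarith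
  subst hp' hq'
  field_simp
  ring

theorem R3.norm_sq (x : R3) : ‖x‖ ^ 2 = ∑ j, x j ^ 2 := by
  rw [EuclideanSpace.norm_sq_eq]
  simp

theorem R3.abs_apply_le (x : R3) (j : Fin 3) : |x j| ≤ ‖x‖ := PiLp.norm_apply_le x j

/-- Each sum must show a factor `‖z + e‖` and a power of the norm of the frequency measured in `L²`.
A missing `‖z + e‖` is created by writing `z + e` as its norm times Riesz symbols; in the third sum
the missing `‖e‖` comes from `e_j e_i / ‖e‖`. -/
theorem commutatorSymbol_eq {U : Fin 3 → ℂ} {w g : ℂ} (z e : R3)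
    (hdiv : ∑ i, (z i : ℂ) * U i = 0) :
    ∑ i, ((‖z + e‖ - ‖e‖ : ℝ) : ℂ) * (U i * ((e i : ℂ) * w) * g) =
      (∑ i, ∑ j, 4 * (((‖z‖ ^ (0 + 1) * ‖z + e‖ / (‖z‖ + ‖e‖ + ‖z + e‖) ^ (0 + 2) : ℝ) : ℂ)
        * ((z j : ℂ) * U i * ((e j : ℂ) * w) * ((((z + e) i / ‖z + e‖ : ℝ) : ℂ) * g))))
      + (∑ i, ∑ j, 2 * (((‖e‖ ^ (0 + 1) * ‖z + e‖ / (‖z‖ + ‖e‖ + ‖z + e‖) ^ (0 + 2) : ℝ) : ℂ)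
        * ((z j : ℂ) * U i * ((e i : ℂ) * w) * ((((z + e) j / ‖z + e‖ : ℝ) : ℂ) * g))))
      + (∑ i, ∑ j, 2 * (((‖e‖ ^ (0 + 1) * ‖z + e‖ / (‖z‖ + ‖e‖ + ‖z + e‖) ^ (0 + 2) : ℝ) : ℂ)
        * ((z j : ℂ) * U i * (((e j * e i / ‖e‖ : ℝ) : ℂ) * w) * g)))
      + (∑ i, 4 * (((‖z‖ ^ (1 + 1) * ‖z + e‖ / (‖z‖ + ‖e‖ + ‖z + e‖) ^ (1 + 2) : ℝ) : ℂ)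
        * ((‖z‖ : ℂ) * U i * ((e i : ℂ) * w) * g)))
      + (∑ i, ∑ j, 4 * (((‖z‖ ^ (1 + 1) * ‖z + e‖ / (‖z‖ + ‖e‖ + ‖z + e‖) ^ (1 + 2) : ℝ) : ℂ)
        * ((z j : ℂ) * U i * ((e i : ℂ) * w) * ((((z + e) j / ‖z + e‖ : ℝ) : ℂ) * g)))) := by
  -- This also holds at `z + e = 0`, where the quotient is `0 / 0 = 0`.
  have hcρ : ∀ i, (‖z + e‖ : ℂ) * (((z + e) i / ‖z + e‖ : ℝ) : ℂ) = z i + e i := by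
    intro i
    rcases eq_or_ne ‖z + e‖ 0 with h0 | h0
    · have h1 : (z + e) i = 0 := by rw [norm_eq_zero.1 h0]; rfl
      have h2 : ((z i : ℂ) + e i) = (((z + e) i : ℝ) : ℂ) := by simp
      rw [h2, h1, h0]; simp
    · rw [← Complex.ofReal_mul, mul_div_cancel₀ _ h0]; simp
  have hbτ : ∀ i j, (‖e‖ : ℂ) * ((e j * e i / ‖e‖ : ℝ) : ℂ) = e j * e i := by
    intro i j
    rcases eq_or_ne ‖e‖ 0 with h0 | h0
    · have h1 : e i = 0 := by rw [norm_eq_zero.1 h0]; rfl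
      rw [h1, h0]; simp
    · rw [← Complex.ofReal_mul, mul_div_cancel₀ _ h0]; simp
  obtain ⟨ρ, hρ⟩ : ∃ ρ : Fin 3 → ℂ, ∀ i, (((z + e) i / ‖z + e‖ : ℝ) : ℂ) = ρ i :=
    ⟨_, fun _ => rfl⟩
  obtain ⟨τ, hτ⟩ : ∃ τ : Fin 3 → Fin 3 → ℂ, ∀ i j, ((e j * e i / ‖e‖ : ℝ) : ℂ) = τ i j :=
    ⟨_, fun _ _ => rfl⟩
  simp only [hρ] at hcρ
  simp only [hτ] at hbτ
  set R : ℂ := (((‖z‖ + ‖e‖ + ‖z + e‖)⁻¹ : ℝ) : ℂ) with hR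
  have hH : ((‖z + e‖ : ℂ) - ‖e‖) = (4 * ‖z‖ * (∑ j, (z j : ℂ) * e j)
      + 2 * ‖e‖ * (∑ j, (z j : ℂ) * (z j + e j)) + 2 * ‖z + e‖ * (∑ j, (z j : ℂ) * e j)) * R ^ 2
      + 4 * ‖z‖ ^ 2 * (‖z‖ * ‖z + e‖ + ∑ j, (z j : ℂ) * (z j + e j)) * R ^ 3 := by
    have hz := R3.norm_sq z
    have he := R3.norm_sq e
    have hze := R3.norm_sq (z + e)
    rcases (by positivity : 0 ≤ ‖z‖ + ‖e‖ + ‖z + e‖).eq_or_lt with h0 | h0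
    · have h1 : ‖e‖ = 0 := by linarith [norm_nonneg z, norm_nonneg e, norm_nonneg (z + e)]
      have h2 : ‖z + e‖ = 0 := by linarith [norm_nonneg z, norm_nonneg e, norm_nonneg (z + e)]
      have h3 : ‖z‖ = 0 := by linarith [norm_nonneg z, norm_nonneg e, norm_nonneg (z + e)]
      rw [h1, h2, h3]
      simp
    · have := sub_eq_commutatorSymbol (a := ‖z‖) (b := ‖e‖) (c := ‖z + e‖)
        (p := ∑ j, z j * e j) (q := ∑ j, z j * (z j + e j)) h0
        (by rw [hz, he, hze]; simp only [Fin.sum_univ_three, PiLp.add_apply]; ring)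
        (by rw [hz, he, hze]; simp only [Fin.sum_univ_three, PiLp.add_apply]; ring)
      have h4 := congrArg (fun r : ℝ => (r : ℂ)) this
      simp only [hR]
      push_cast at h4 ⊢
      rw [h4]
      simp only [div_eq_mul_inv, inv_pow]
  have hdivR : ∀ n (x : ℝ), ((x / (‖z‖ + ‖e‖ + ‖z + e‖) ^ n : ℝ) : ℂ) = x * R ^ n := by
    intro n x
    rw [hR, div_eq_mul_inv, ← inv_pow]
    push_cast
    ring
  simp only [hdivR, hρ, hτ, Complex.ofReal_mul, Complex.ofReal_pow, Complex.ofReal_sub, zero_add,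
    pow_one]
  have t1 : ∀ i j, 4 * ((‖z‖ : ℂ) * ‖z + e‖ * R ^ 2 * (z j * U i * (e j * w) * (ρ i * g)))
      = 4 * (‖z‖ * R ^ 2 * (z j * U i * (e j * w) * ((z i + e i) * g))) := by
    intro i j; rw [← hcρ i]; ring
  have t2 : ∀ i j, 2 * ((‖e‖ : ℂ) * ‖z + e‖ * R ^ 2 * (z j * U i * (e i * w) * (ρ j * g)))
      = 2 * (‖e‖ * R ^ 2 * (z j * U i * (e i * w) * ((z j + e j) * g))) := by
    intro i j; rw [← hcρ j]; ring
  have t3 : ∀ i j, 2 * ((‖e‖ : ℂ) * ‖z + e‖ * R ^ 2 * (z j * U i * (τ i j * w) * g))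
      = 2 * (‖z + e‖ * R ^ 2 * (z j * U i * (e j * e i * w) * g)) := by
    intro i j; rw [← hbτ i j]; ring
  have t5 : ∀ i j, 4 * ((‖z‖ : ℂ) ^ (1 + 1) * ‖z + e‖ * R ^ (1 + 2)
        * (z j * U i * (e i * w) * (ρ j * g)))
      = 4 * (‖z‖ ^ 2 * R ^ 3 * (z j * U i * (e i * w) * ((z j + e j) * g))) := by
    intro i j; rw [← hcρ j]; ring
  have hlhs : ∀ i, ((‖z + e‖ : ℂ) - ‖e‖) * (U i * (e i * w) * g)
      = ((4 * ‖z‖ * (∑ j, (z j : ℂ) * e j)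
      + 2 * ‖e‖ * (∑ j, (z j : ℂ) * (z j + e j)) + 2 * ‖z + e‖ * (∑ j, (z j : ℂ) * e j)) * R ^ 2
      + 4 * ‖z‖ ^ 2 * (‖z‖ * ‖z + e‖ + ∑ j, (z j : ℂ) * (z j + e j)) * R ^ 3)
        * (U i * (e i * w) * g) := fun i => by rw [hH]
  simp only [t1, t2, t3, t5, hlhs]
  simp only [Fin.sum_univ_three] at hdiv ⊢
  -- The divergence condition enters only here: in the first sum it permits `∑ U i * e i` to be
  -- replaced by `∑ U i * (z + e) i`, which supplies the factor `‖z + e‖`.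
  linear_combination (-4 * ‖z‖ * R ^ 2 * (z 0 * e 0 + z 1 * e 1 + z 2 * e 2) * w * g) * hdiv

/-- The Fourier-side commutator estimate, tested against `γ`. -/
theorem commutator_integralBound (U : Fin 3 → SchwartzMap R3 ℂ) (k : Fin 3)
    (hdiv : ∀ ξ : R3, ∑ i, (ξ i : ℂ) * U i ξ = 0) {M : ℝ} (hM : 0 < M)
    (hU : ∀ i j, PoissonBounded (fun ξ : R3 => (ξ j : ℂ) * U i ξ) M)
    {E : ℝ} (hE : ∀ i, ∫ ξ, ‖ξ‖ ^ 2 * ‖U i ξ‖ ^ 2 ≤ E)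
    {γ : R3 → ℂ} {Q : ℝ} (hγ : TestBounded γ Q) {l : ℝ} (hl : 0 < l) :
    IntegralBound (volume.prod volume) (fun p : R3 × R3 =>
      ∑ i, ((‖p.1 + p.2‖ - ‖p.2‖ : ℝ) : ℂ) * (U i p.1 * ((p.2 i : ℂ) * U k p.2) * γ (p.1 + p.2)))
      (720 * (M * (l * E + l⁻¹ * Q))) := by
  have hcoord : ∀ j, Measurable fun x : R3 => x j := fun j => by fun_prop
  have hsq : ∀ i (m : R3 → ℝ), Measurable m → (∀ x, |m x| ≤ ‖x‖) →
      SquareBounded (fun x => (m x : ℂ) * U i x) E := fun i m h1 h2 =>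
    have h := squareBounded_mul_schwartz (U i) h1 h2
    ⟨h.1, h.2.1, h.2.2.trans (hE i)⟩
  have hγρ : ∀ j, TestBounded (fun x : R3 => ((x j / ‖x‖ : ℝ) : ℂ) * γ x) Q := fun j =>
    hγ.mul (by fun_prop) fun x => by
      rw [abs_div, abs_norm]
      exact div_le_one_of_le₀ (R3.abs_apply_le x j) (norm_nonneg _)
  have hτ : ∀ i j, SquareBounded (fun x : R3 => ((x j * x i / ‖x‖ : ℝ) : ℂ) * U k x) E := fun i j =>
    hsq k _ (by fun_prop) fun x => by
      rw [abs_div, abs_norm, abs_mul]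
      refine div_le_of_le_mul₀ (norm_nonneg _) (norm_nonneg _) ?_
      exact mul_le_mul (R3.abs_apply_le x j) (R3.abs_apply_le x i) (abs_nonneg _) (norm_nonneg _)
  have hzU : ∀ i j, SquareBounded (fun x : R3 => (x j : ℂ) * U i x) E := fun i j =>
    hsq i (fun x => x j) (hcoord j) fun x => R3.abs_apply_le x j
  have hnU : ∀ i, SquareBounded (fun x : R3 => (‖x‖ : ℂ) * U i x) E := fun i =>
    hsq i (fun x => ‖x‖) measurable_norm fun x => (abs_norm x).le
  -- In `t1`, `t4`, `t5` the advected field has the bounded gradient and the advecting one is in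
  -- `L²`; in `t2`, `t3` the roles are exchanged.
  have t1 := IntegralBound.sum fun i => IntegralBound.sum fun j =>
    (bilinearSymbol_left 0 hM hl (hU k j) (hzU i j) (hγρ i)).const_mul 4
  have t2 := IntegralBound.sum fun i => IntegralBound.sum fun j =>
    (bilinearSymbol_right 0 hM hl (hU i j) (hzU k i) (hγρ j)).const_mul 2
  have t3 := IntegralBound.sum fun i => IntegralBound.sum fun j =>
    (bilinearSymbol_right 0 hM hl (hU i j) (hτ i j) hγ).const_mul 2
  have t4 := IntegralBound.sum fun i =>
    (bilinearSymbol_left 1 hM hl (hU k i) (hnU i) hγ).const_mul 4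
  have t5 := IntegralBound.sum fun i => IntegralBound.sum fun j =>
    (bilinearSymbol_left 1 hM hl (hU k i) (hzU i j) (hγρ j)).const_mul 4
  have e : (fun p : R3 × R3 => ∑ i, ((‖p.1 + p.2‖ - ‖p.2‖ : ℝ) : ℂ)
      * (U i p.1 * ((p.2 i : ℂ) * U k p.2) * γ (p.1 + p.2))) = _ :=
    funext fun p => commutatorSymbol_eq p.1 p.2 (hdiv p.1)
  rw [e]
  refine ((((t1.add t2).add t3).add t4).add t5).mono ?_
  have hE0 : 0 ≤ E := le_trans (integral_nonneg fun x => by positivity) (hE 0)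
  have hQ0 : 0 ≤ Q := le_trans (integral_nonneg fun x => by positivity) hγ.2.2.2
  have hX : 0 ≤ M * (l * E + l⁻¹ * Q) := by positivity
  set X := M * (l * E + l⁻¹ * Q)
  -- The five sums contribute `36 + 18 + 18 + 72 + 216 = 360` times `X`.
  norm_num [Nat.factorial]
  linarith

end Commutator

/-! ### Nested logarithms: convergence of the products and the lower bound for `F₁`. -/

section LogFactors

theorem nestedLog_nonneg {Z : ℝ} (hZ : 0 ≤ Z) : ∀ k, 0 ≤ nestedLog k Z
  | 0 => hZ
  | k + 1 => by
    have h := nestedLog_nonneg hZ k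
    refine Real.log_nonneg ?_
    linarith [Real.add_one_le_exp (1 : ℝ)]

theorem one_le_nestedLog_succ {Z : ℝ} (hZ : 0 ≤ Z) (k : ℕ) : 1 ≤ nestedLog (k + 1) Z := by
  have h := nestedLog_nonneg hZ k
  rw [nestedLog, Real.le_log_iff_exp_le (by positivity)]
  linarith

/-- Since `e ≥ 2`, `log (e + y) ≤ 1 + y / 2`, and this affine map preserves the bound `y ≤ 2 + L_2`.
Uniformity in `j` reduces the convergence of the products to that of `∑ δ_j`. -/
theorem nestedLog_add_two_le {Z : ℝ} (hZ : 0 ≤ Z) (j : ℕ) :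
    nestedLog (j + 2) Z ≤ 2 + nestedLog 2 Z := by
  induction j with
  | zero => simp
  | succ j ih =>
    have h := nestedLog_nonneg hZ (j + 2)
    have h2 := nestedLog_nonneg hZ 2
    have he := Real.add_one_le_exp (1 : ℝ)
    have h3 : nestedLog (j + 1 + 2) Z ≤ 1 + nestedLog (j + 2) Z / 2 := by
      rw [show j + 1 + 2 = (j + 2) + 1 by ring, nestedLog,
        Real.log_le_iff_le_exp (by positivity), Real.exp_add]
      have h4 := Real.add_one_le_exp (nestedLog (j + 2) Z / 2)
      nlinarith
    linarith

variable {δ : ℕ → ℝ}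

theorem log_one_add_nestedLog_bounds {Z : ℝ} (hZ : 0 ≤ Z) (j : ℕ) :
    0 ≤ Real.log (1 + nestedLog (j + 2) Z) ∧
      Real.log (1 + nestedLog (j + 2) Z) ≤ Real.log (3 + nestedLog 2 Z) := by
  have h := nestedLog_nonneg hZ (j + 2)
  refine ⟨Real.log_nonneg (by linarith), Real.log_le_log (by linarith) ?_⟩
  linarith [nestedLog_add_two_le hZ j]

theorem summable_mul_log_nestedLog (hδ : ∀ j, 1 ≤ j → 0 < δ j) (hsum : Summable δ) {Z : ℝ}
    (hZ : 0 ≤ Z) : Summable fun j : ℕ => δ (j + 2) * Real.log (1 + nestedLog (j + 2) Z) := by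
  have hs : Summable fun j : ℕ => δ (j + 2) := (summable_nat_add_iff 2).2 hsum
  refine Summable.of_nonneg_of_le (fun j => ?_) (fun j => ?_)
    (hs.mul_right (Real.log (3 + nestedLog 2 Z)))
  · exact mul_nonneg (hδ _ (by omega)).le (log_one_add_nestedLog_bounds hZ j).1
  · exact mul_le_mul_of_nonneg_left (log_one_add_nestedLog_bounds hZ j).2 (hδ _ (by omega)).le

theorem log_nestedLog_rpow {Z : ℝ} (hZ : 0 ≤ Z) (j : ℕ) (s : ℝ) :
    Real.log ((1 + nestedLog (j + 2) Z) ^ s) = s * Real.log (1 + nestedLog (j + 2) Z) :=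
  Real.log_rpow (by linarith [nestedLog_nonneg hZ (j + 2)]) s

theorem nestedLog_rpow_pos {Z : ℝ} (hZ : 0 ≤ Z) (j : ℕ) (s : ℝ) :
    0 < (1 + nestedLog (j + 2) Z) ^ s :=
  Real.rpow_pos_of_pos (by linarith [nestedLog_nonneg hZ (j + 2)]) s

theorem summable_log_nestedLog_rpow_neg (hδ : ∀ j, 1 ≤ j → 0 < δ j) (hsum : Summable δ) {Z : ℝ}
    (hZ : 0 ≤ Z) :
    Summable fun j : ℕ => Real.log ((1 + nestedLog (j + 2) Z) ^ (-δ (j + 2))) := by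
  refine (summable_mul_log_nestedLog hδ hsum hZ).neg.congr fun j => ?_
  rw [log_nestedLog_rpow hZ, neg_mul]

theorem multipliable_nestedLog (hδ : ∀ j, 1 ≤ j → 0 < δ j) (hsum : Summable δ) {Z : ℝ}
    (hZ : 0 ≤ Z) :
    Multipliable (fun j : ℕ => (1 + nestedLog (j + 2) Z) ^ (-δ (j + 2))) ∧
      Multipliable (fun j : ℕ => (1 + nestedLog (j + 2) Z) ^ (δ (j + 2))) := by
  refine ⟨Real.multipliable_of_summable_log (fun j => nestedLog_rpow_pos hZ j _)
    (summable_log_nestedLog_rpow_neg hδ hsum hZ),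
    Real.multipliable_of_summable_log (fun j => nestedLog_rpow_pos hZ j _)
    ((summable_mul_log_nestedLog hδ hsum hZ).congr fun j => ?_)⟩
  rw [log_nestedLog_rpow hZ]

theorem logFactorTwo_nonneg (hδ : ∀ j, 1 ≤ j → 0 < δ j) (hsum : Summable δ) {Z : ℝ}
    (hZ : 0 ≤ Z) : 0 ≤ logFactorTwo δ Z := by
  have h1 := nestedLog_nonneg hZ 1
  have h2 : 0 ≤ ∏' j : ℕ, (1 + nestedLog (j + 2) Z) ^ (δ (j + 2)) := by
    rw [← Real.rexp_tsum_eq_tprod (fun j => nestedLog_rpow_pos hZ j _)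
      ((summable_mul_log_nestedLog hδ hsum hZ).congr fun j => by rw [log_nestedLog_rpow hZ])]
    positivity
  rw [logFactorTwo]
  positivity

/-- The factor `L₁` dominates the product of the iterated logarithms. -/
theorem exists_le_logFactorOne (hδ : ∀ j, 1 ≤ j → 0 < δ j) (hsum : Summable δ) :
    ∃ c : ℝ, 0 < c ∧ ∀ Z : ℝ, 0 ≤ Z → c ≤ logFactorOne δ Z := by
  set D : ℝ := ∑' j : ℕ, δ (j + 2) with hD
  have hD0 : 0 ≤ D := tsum_nonneg fun j => (hδ _ (by omega)).le
  refine ⟨Real.exp (-(3 + Real.log 4 + D * Real.log (D + 1))), Real.exp_pos _, fun Z hZ => ?_⟩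
  have hx := one_le_nestedLog_succ hZ 0
  have hs : Summable fun j : ℕ => δ (j + 2) := (summable_nat_add_iff 2).2 hsum
  rw [logFactorOne, ← Real.rexp_tsum_eq_tprod (fun j => nestedLog_rpow_pos hZ j _)
    (summable_log_nestedLog_rpow_neg hδ hsum hZ)]
  simp only [log_nestedLog_rpow hZ, neg_mul]
  rw [tsum_neg]
  have h1 : ∑' j : ℕ, δ (j + 2) * Real.log (1 + nestedLog (j + 2) Z)
      ≤ D * Real.log (3 + nestedLog 2 Z) := by
    rw [hD, ← tsum_mul_right]
    exact (summable_mul_log_nestedLog hδ hsum hZ).tsum_le_tsum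
      (fun j => mul_le_mul_of_nonneg_left (log_one_add_nestedLog_bounds hZ j).2
        (hδ _ (by omega)).le) (hs.mul_right _)
  set x := nestedLog 1 Z with hxdef
  have hx1 : 1 ≤ x := hx
  have h2 : nestedLog 2 Z ≤ Real.log 4 + Real.log x := by
    rw [show nestedLog 2 Z = Real.log (Real.exp 1 + x) from rfl,
      ← Real.log_mul (by norm_num) (by linarith)]
    refine Real.log_le_log (by positivity) ?_
    linarith [Real.exp_one_lt_d9]
  have hlx : 0 ≤ Real.log x := Real.log_nonneg hx1
  have h20 := nestedLog_nonneg hZ 2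
  have hl4 : 0 ≤ Real.log 4 := Real.log_nonneg (by norm_num)
  -- The tangent line of `log` at `D + 1`: after multiplication by `D` the coefficient of `log x` is
  -- `D / (D + 1) ≤ 1`, so the prefactor `x` compensates it.
  have h3 : Real.log (3 + nestedLog 2 Z) ≤ (3 + Real.log 4 + Real.log x) / (D + 1)
      + Real.log (D + 1) := by
    have h4 := Real.log_le_sub_one_of_pos (x := (3 + nestedLog 2 Z) / (D + 1)) (by positivity)
    rw [Real.log_div (by positivity) (by positivity)] at h4
    have h5 : (3 + nestedLog 2 Z) / (D + 1) ≤ (3 + Real.log 4 + Real.log x) / (D + 1) := by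
      exact div_le_div_of_nonneg_right (by linarith) (by linarith)
    linarith
  have h6 : D * Real.log (3 + nestedLog 2 Z)
      ≤ (3 + Real.log 4 + Real.log x) + D * Real.log (D + 1) := by
    refine (mul_le_mul_of_nonneg_left h3 hD0).trans ?_
    rw [mul_add]
    have h7 : D * ((3 + Real.log 4 + Real.log x) / (D + 1)) ≤ 3 + Real.log 4 + Real.log x := by
      rw [← mul_div_assoc, div_le_iff₀ (by positivity)]
      nlinarith
    linarith
  calc Real.exp (-(3 + Real.log 4 + D * Real.log (D + 1)))
      = x * Real.exp (-((3 + Real.log 4 + Real.log x) + D * Real.log (D + 1))) := by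
        nth_rewrite 1 [← Real.exp_log (by linarith : 0 < x)]
        rw [← Real.exp_add]
        congr 1
        ring
    _ ≤ _ := by
        gcongr
        exact h1.trans h6

end LogFactors

/-! ### The commutator on the Fourier side and its `L²` bound. -/

section CommutatorKernel

/-- The scalar convolution product. -/
noncomputable def mulConv (f g : R3 → ℂ) : R3 → ℂ := convolution f g (ContinuousLinearMap.mul ℂ ℂ) volume

theorem mulConv_apply (f g : R3 → ℂ) (ξ : R3) : mulConv f g ξ = ∫ ζ, f ζ * g (ξ - ζ) := rfl

theorem fourierInv_mulConv {f g : R3 → ℂ} (hf : Integrable f) (hg : Integrable g) (x : R3) :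
    𝓕⁻ (mulConv f g) x = 𝓕⁻ f x * 𝓕⁻ g x := by
  rw [Real.fourierInv_eq_fourier_neg, Real.fourierInv_eq_fourier_neg,
    Real.fourierInv_eq_fourier_neg]
  exact Real.fourier_mul_convolution_eq hf hg (-x)

/-- A continuous, integrable and bounded function. -/
def NiceFunction (f : R3 → ℂ) : Prop :=
  Integrable f ∧ Continuous f ∧ ∃ B, ∀ x, ‖f x‖ ≤ B

theorem NiceFunction.mulConv {f g : R3 → ℂ} (hf : Integrable f) (hg : NiceFunction g) :
    NiceFunction (mulConv f g) := by
  obtain ⟨h1, h2, B, hB⟩ := hg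
  refine ⟨hf.integrable_convolution _ h1, ?_, (∫ ζ, ‖f ζ‖) * B, fun x => ?_⟩
  · refine BddAbove.continuous_convolution_right_of_integrable _ ⟨B, ?_⟩ hf h2
    rintro _ ⟨x, rfl⟩
    exact hB x
  · rw [mulConv_apply, ← integral_mul_const]
    refine norm_integral_le_of_norm_le (hf.norm.mul_const B)
      (Filter.Eventually.of_forall fun ζ => ?_)
    rw [norm_mul]
    exact mul_le_mul_of_nonneg_left (hB _) (norm_nonneg _)

theorem NiceFunction.sub {f g : R3 → ℂ} (hf : NiceFunction f) (hg : NiceFunction g) :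
    NiceFunction fun x => f x - g x := by
  obtain ⟨h1, h2, B, hB⟩ := hf
  obtain ⟨h3, h4, B', hB'⟩ := hg
  exact ⟨h1.sub h3, h2.sub h4, B + B', fun x =>
    (norm_sub_le _ _).trans (add_le_add (hB x) (hB' x))⟩

theorem NiceFunction.sum {f : Fin 3 → R3 → ℂ} (hf : ∀ i, NiceFunction (f i)) :
    NiceFunction fun x => ∑ i, f i x := by
  choose h1 h2 B hB using hf
  exact ⟨integrable_finsetSum _ fun i _ => h1 i, continuous_finsetSum _ fun i _ => h2 i, ∑ i, B i,
    fun x => (norm_sum_le _ _).trans (Finset.sum_le_sum fun i _ => hB i x)⟩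

theorem niceFunction_schwartz (f : SchwartzMap R3 ℂ) : NiceFunction f := by
  obtain ⟨C, hC⟩ := f.decay 0 0
  exact ⟨f.integrable, f.continuous, C, fun x => by simpa using hC.2 x⟩

theorem niceFunction_norm_mul_schwartz (f : SchwartzMap R3 ℂ) :
    NiceFunction fun ξ => ((2 * Real.pi * ‖ξ‖ : ℝ) : ℂ) * f ξ := by
  obtain ⟨C, hC⟩ := f.norm_mul_norm_le
  have hn : ∀ ξ, ‖((2 * Real.pi * ‖ξ‖ : ℝ) : ℂ) * f ξ‖ = 2 * Real.pi * (‖ξ‖ * ‖f ξ‖) := fun ξ => by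
    rw [norm_mul, Complex.norm_real, Real.norm_of_nonneg (by positivity)]; ring
  have hc : Continuous fun ξ => ((2 * Real.pi * ‖ξ‖ : ℝ) : ℂ) * f ξ := by fun_prop
  refine ⟨?_, hc, 2 * Real.pi * C, fun ξ => ?_⟩
  · have h := (f.integrable_pow_mul volume 1).const_mul (2 * Real.pi)
    refine h.mono' hc.aestronglyMeasurable (Filter.Eventually.of_forall fun ξ => ?_)
    rw [hn, pow_one]
  · rw [hn]
    gcongr
    exact hC ξ

/-- The Fourier transform of the `k`-th component of the commutator, where `U` is the Fourier
transform of the velocity and `G i` that of the `i`-th partial derivative of its component. -/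
noncomputable def commutatorKernel (U G : Fin 3 → SchwartzMap R3 ℂ) (ξ : R3) : ℂ :=
  ∑ i, (((2 * Real.pi * ‖ξ‖ : ℝ) : ℂ) * mulConv (U i) (G i) ξ
    - mulConv (U i) (fun η => ((2 * Real.pi * ‖η‖ : ℝ) : ℂ) * G i η) ξ)

theorem mulConv_schwartz (f g : SchwartzMap R3 ℂ) :
    (SchwartzMap.convolution (ContinuousLinearMap.mul ℂ ℂ) f g : R3 → ℂ) = mulConv f g := by
  ext ξ
  exact SchwartzMap.convolution_apply _ f g ξ

theorem niceFunction_commutatorKernel (U G : Fin 3 → SchwartzMap R3 ℂ) :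
    NiceFunction (commutatorKernel U G) := by
  refine NiceFunction.sum fun i => NiceFunction.sub ?_ ?_
  · rw [← mulConv_schwartz]
    exact niceFunction_norm_mul_schwartz _
  · exact NiceFunction.mulConv (U i).integrable (niceFunction_norm_mul_schwartz _)

/-- The constant is the `2π` of the symbol of `Λ` times the `2πi` of the derivative. The argument is
written `-ζ + ξ` to match the shear used to change variables. -/
theorem commutatorKernel_eq_integral (U G : Fin 3 → SchwartzMap R3 ℂ) (W : SchwartzMap R3 ℂ)
    (hG : ∀ i (ξ : R3), G i ξ = 2 * Real.pi * Complex.I * (ξ i : ℂ) * W ξ) (ξ : R3) :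
    commutatorKernel U G ξ = (4 * Real.pi ^ 2 * Complex.I) * ∫ ζ, ∑ i,
      ((‖ξ‖ - ‖-ζ + ξ‖ : ℝ) : ℂ) * (U i ζ * (((-ζ + ξ) i : ℂ) * W (-ζ + ξ))) := by
  have hint : ∀ (i : Fin 3) {g : R3 → ℂ}, NiceFunction g →
      Integrable fun ζ => U i ζ * g (ξ - ζ) := by
    intro i g hg
    obtain ⟨h1, h2, B, hB⟩ := hg
    refine (U i).integrable.mul_bdd (c := B) ?_ (Filter.Eventually.of_forall fun ζ => hB _)
    exact (h2.comp (continuous_const.sub continuous_id)).aestronglyMeasurable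
  have e : ∀ i, (((2 * Real.pi * ‖ξ‖ : ℝ) : ℂ) * mulConv (U i) (G i) ξ
      - mulConv (U i) (fun η => ((2 * Real.pi * ‖η‖ : ℝ) : ℂ) * G i η) ξ)
      = ∫ ζ, (((2 * Real.pi * ‖ξ‖ : ℝ) : ℂ) * (U i ζ * G i (ξ - ζ))
        - U i ζ * (((2 * Real.pi * ‖ξ - ζ‖ : ℝ) : ℂ) * G i (ξ - ζ))) := by
    intro i
    rw [integral_sub ((hint i (niceFunction_schwartz _)).const_mul _)
      (hint i (niceFunction_norm_mul_schwartz (G i))), integral_const_mul]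
    rfl
  rw [commutatorKernel]
  simp only [e]
  rw [← integral_finsetSum, ← integral_const_mul]
  · refine integral_congr_ae (Filter.Eventually.of_forall fun ζ => ?_)
    simp only [Finset.mul_sum]
    refine Finset.sum_congr rfl fun i _ => ?_
    rw [hG, neg_add_eq_sub]
    push_cast
    ring
  · intro i _
    exact ((hint i (niceFunction_schwartz _)).const_mul _).sub
      (hint i (niceFunction_norm_mul_schwartz (G i)))

/-- Duality: the kernel is tested against its own conjugate, and its square norm `N`, known to be
finite, is absorbed. -/
theorem integral_norm_sq_commutatorKernel_le (U G : Fin 3 → SchwartzMap R3 ℂ) (k : Fin 3)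
    (hG : ∀ i (ξ : R3), G i ξ = 2 * Real.pi * Complex.I * (ξ i : ℂ) * U k ξ)
    (hdiv : ∀ ξ : R3, ∑ i, (ξ i : ℂ) * U i ξ = 0) {M : ℝ} (hM : 0 < M)
    (hU : ∀ i j, PoissonBounded (fun ξ : R3 => (ξ j : ℂ) * U i ξ) M)
    {E : ℝ} (hE : ∀ i, ∫ ξ, ‖ξ‖ ^ 2 * ‖U i ξ‖ ^ 2 ≤ E) :
    ∫ ξ, ‖commutatorKernel U G ξ‖ ^ 2 ≤ (5760 * Real.pi ^ 2 * M) ^ 2 * E := by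
  set K := commutatorKernel U G with hK
  obtain ⟨hK1, hK2, B, hB⟩ := niceFunction_commutatorKernel U G
  set N := ∫ ξ, ‖K ξ‖ ^ 2 with hN
  have hγ : TestBounded (fun ξ => (starRingEnd ℂ) (K ξ)) N := by
    have hc : Continuous fun ξ => (starRingEnd ℂ) (K ξ) := Complex.continuous_conj.comp hK2
    refine ⟨hK1.mono hc.aestronglyMeasurable (Filter.Eventually.of_forall fun x => (RCLike.norm_conj _).le),
      hc.measurable, ⟨B, fun x => by simpa using hB x⟩, le_of_eq ?_⟩
    simp [hN]
  -- Twice `4π² * 720 * M`, so that the term in `N` on the right becomes `N / 2` and the other one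
  -- `l² E / 2`.
  set l : ℝ := 5760 * Real.pi ^ 2 * M with hl
  have hl0 : 0 < l := by positivity
  obtain ⟨hF, hFle⟩ := commutator_integralBound U k hdiv hM hU hE hγ hl0
  set F : R3 × R3 → ℂ := fun p => ∑ i, ((‖p.1 + p.2‖ - ‖p.2‖ : ℝ) : ℂ)
    * (U i p.1 * ((p.2 i : ℂ) * U k p.2) * (starRingEnd ℂ) (K (p.1 + p.2))) with hFdef
  have hmp := measurePreserving_prod_neg_add (volume : Measure R3) (volume : Measure R3)
  have hemb : MeasurableEmbedding fun p : R3 × R3 => (p.1, -p.1 + p.2) :=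
    (MeasurableEquiv.shearAddRight R3).symm.measurableEmbedding
  have hF' : Integrable (fun p : R3 × R3 => F (p.1, -p.1 + p.2)) (volume.prod volume) :=
    (hmp.integrable_comp_emb hemb).2 hF
  have e1 : ∫ p, F p ∂(volume.prod volume) = ∫ ξ, ∫ ζ, F (ζ, -ζ + ξ) := by
    rw [← hmp.integral_comp hemb, integral_prod_symm _ hF']
  have e2 : ∀ ξ, (4 * Real.pi ^ 2 * Complex.I) * ∫ ζ, F (ζ, -ζ + ξ) = ((‖K ξ‖ ^ 2 : ℝ) : ℂ) := by
    intro ξ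
    have h1 : ((‖K ξ‖ ^ 2 : ℝ) : ℂ) = K ξ * (starRingEnd ℂ) (K ξ) := by
      rw [Complex.mul_conj, Complex.normSq_eq_norm_sq]
    have h2 : K ξ * (starRingEnd ℂ) (K ξ) = (4 * Real.pi ^ 2 * Complex.I) * ∫ ζ, (∑ i,
      ((‖ξ‖ - ‖-ζ + ξ‖ : ℝ) : ℂ) * (U i ζ * (((-ζ + ξ) i : ℂ) * U k (-ζ + ξ))))
        * (starRingEnd ℂ) (K ξ) := by
      rw [integral_mul_const, ← mul_assoc, ← commutatorKernel_eq_integral U G (U k) hG ξ]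
    rw [h1, h2]
    congr 1
    refine integral_congr_ae (Filter.Eventually.of_forall fun ζ => ?_)
    simp only [hFdef, add_neg_cancel_left, Finset.sum_mul]
    refine Finset.sum_congr rfl fun i _ => ?_
    ring
  have e3 : (N : ℂ) = (4 * Real.pi ^ 2 * Complex.I) * ∫ p, F p ∂(volume.prod volume) := by
    rw [e1, ← integral_const_mul, hN, ← integral_complex_ofReal]
    refine integral_congr_ae (Filter.Eventually.of_forall fun ξ => ?_)
    exact (e2 ξ).symm
  have hN0 : 0 ≤ N := integral_nonneg fun ξ => by positivity
  have e4 : N ≤ 4 * Real.pi ^ 2 * (720 * (M * (l * E + l⁻¹ * N))) := by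
    have h1 : ‖(N : ℂ)‖ = N := by rw [Complex.norm_real, Real.norm_of_nonneg hN0]
    have h2 : ‖(4 * Real.pi ^ 2 * Complex.I : ℂ)‖ = 4 * Real.pi ^ 2 := by
      rw [norm_mul, Complex.norm_I, mul_one, show (4 * Real.pi ^ 2 : ℂ)
        = ((4 * Real.pi ^ 2 : ℝ) : ℂ) by push_cast; rfl, Complex.norm_real,
        Real.norm_of_nonneg (by positivity)]
    calc N = ‖(N : ℂ)‖ := h1.symm
      _ = 4 * Real.pi ^ 2 * ‖∫ p, F p ∂(volume.prod volume)‖ := by rw [e3, norm_mul, h2]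
      _ ≤ _ := mul_le_mul_of_nonneg_left hFle (by positivity)
  have e5 : 4 * Real.pi ^ 2 * (720 * (M * (l * E + l⁻¹ * N))) = l ^ 2 * E / 2 + N / 2 := by
    rw [hl]
    field_simp
    ring
  linarith

end CommutatorKernel

/-! ### Fourier integrals of sums, components and derivatives. -/

section FourierLinearity

theorem integrable_fourierInv_integrand {F : Type*} [NormedAddCommGroup F] [NormedSpace ℂ F]
    {f : R3 → F} (hf : Integrable f) (x : R3) :
    Integrable fun v : R3 => Real.fourierChar (inner ℝ v x) • f v := by
  have h := (Real.fourierIntegral_convergent_iff (-x)).2 hf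
  simpa using h

theorem fourierInv_sum_apply {f : Fin 3 → R3 → ℂ} (hf : ∀ i, Integrable (f i)) (x : R3) :
    𝓕⁻ (fun ξ => ∑ i, f i ξ) x = ∑ i, 𝓕⁻ (f i) x := by
  simp only [Real.fourierInv_eq, Finset.smul_sum]
  exact integral_finsetSum _ fun i _ => integrable_fourierInv_integrand (hf i) x

theorem fourierInv_sub_apply {f g : R3 → ℂ} (hf : Integrable f) (hg : Integrable g) (x : R3) :
    𝓕⁻ (fun ξ => f ξ - g ξ) x = 𝓕⁻ f x - 𝓕⁻ g x := by
  simp only [Real.fourierInv_eq, smul_sub]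
  exact integral_sub (integrable_fourierInv_integrand hf x) (integrable_fourierInv_integrand hg x)

theorem fourierInv_const_mul_apply (c : ℂ) (f : R3 → ℂ) (x : R3) :
    𝓕⁻ (fun ξ => c * f ξ) x = c * 𝓕⁻ f x := by
  simp only [Real.fourierInv_eq, Circle.smul_def, smul_eq_mul]
  rw [← integral_const_mul]
  congr 1
  ext v
  ring

theorem fourierInv_apply_coord {f : R3 → C3} (hf : Integrable f) (x : R3) (k : Fin 3) :
    (𝓕⁻ f x) k = 𝓕⁻ (fun ξ => f ξ k) x := by
  simp only [Real.fourierInv_eq]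
  have h := (EuclideanSpace.proj k : C3 →L[ℂ] ℂ).integral_comp_comm
    (integrable_fourierInv_integrand hf x)
  exact h.symm

theorem fourier_apply_coord {f : R3 → C3} (hf : Integrable f) (x : R3) (k : Fin 3) :
    (𝓕 f x) k = 𝓕 (fun ξ => f ξ k) x := by
  have e : ∀ {F : Type} [NormedAddCommGroup F] [NormedSpace ℂ F] (g : R3 → F), 𝓕 g x = 𝓕⁻ g (-x) :=
    fun g => by rw [Real.fourierInv_eq_fourier_neg, neg_neg]
  rw [e, e, fourierInv_apply_coord hf]

theorem fderiv_fourierInv_apply_coord {g : R3 → C3} (hg : Integrable g)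
    (hg' : Integrable fun ξ => ‖ξ‖ * ‖g ξ‖) (x m : R3) (k : Fin 3) :
    (fderiv ℝ (𝓕⁻ g) x m) k
      = 𝓕⁻ (fun ξ => 2 * Real.pi * Complex.I * (inner ℝ ξ m : ℝ) * g ξ k) x := by
  have h1 : Integrable fun ξ : R3 => g (-ξ) := hg.comp_neg
  have h2 : Integrable fun ξ : R3 => ‖ξ‖ * ‖g (-ξ)‖ := by simpa using hg'.comp_neg
  have h3 : Integrable (VectorFourier.fourierSMulRight (innerSL ℝ) fun ξ : R3 => g (-ξ)) := by
    refine Integrable.mono' (h2.const_mul (2 * Real.pi * ‖innerSL ℝ (E := R3)‖))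
      h1.aestronglyMeasurable.fourierSMulRight
      (Filter.Eventually.of_forall fun ξ => ?_)
    refine (VectorFourier.norm_fourierSMulRight_le _ _ _).trans (le_of_eq (by ring))
  have h4 : Integrable fun ξ : R3 =>
      (VectorFourier.fourierSMulRight (innerSL ℝ) fun ξ : R3 => g (-ξ)) ξ m :=
    h3.apply_continuousLinearMap m
  rw [Real.fourierInv_eq_fourier_comp_neg, Real.fderiv_fourier h1 h2,
    Real.fourier_continuousLinearMap_apply h3, fourier_apply_coord h4,
    Real.fourierInv_eq_fourier_comp_neg]
  refine congrFun (congrArg _ (funext fun ξ => ?_)) x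
  simp only [VectorFourier.fourierSMulRight_apply, PiLp.smul_apply, smul_eq_mul,
    inner_neg_left, Complex.real_smul, Complex.ofReal_neg]
  rw [show innerSL ℝ ξ m = inner ℝ ξ m from rfl]
  ring

theorem fourier_lineDeriv_apply (f : SchwartzMap R3 ℂ) (i : Fin 3) (ξ : R3) :
    (𝓕 (LineDeriv.lineDerivOp (EuclideanSpace.single i (1 : ℝ)) f) : SchwartzMap R3 ℂ) ξ
      = 2 * Real.pi * Complex.I * (ξ i : ℂ) * (𝓕 f : SchwartzMap R3 ℂ) ξ := by
  have ht : (inner ℝ · (EuclideanSpace.single i (1 : ℝ)) : R3 → ℝ).HasTemperateGrowth := by fun_prop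
  rw [SchwartzMap.fourier_lineDerivOp_eq, smul_apply,
    SchwartzMap.smulLeftCLM_apply_apply ht]
  simp [EuclideanSpace.inner_single_right]
  ring

end FourierLinearity

/-! ### Test vector fields as Schwartz functions. -/

section VectorField

theorem contDiff_complexify {u : R3 → R3} (hu : ContDiff ℝ ∞ u) : ContDiff ℝ ∞ (complexify u) := by
  refine (PiLp.continuousLinearEquiv 2 ℝ fun _ : Fin 3 => ℂ).symm.contDiff.comp
    (contDiff_pi.2 fun i => ?_)
  exact Complex.ofRealCLM.contDiff.comp (contDiff_euclidean.1 hu i)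

theorem hasCompactSupport_complexify {u : R3 → R3} (hc : HasCompactSupport u) :
    HasCompactSupport (complexify u) := by
  refine hc.mono fun x hx => ?_
  contrapose! hx
  simp only [Function.mem_support, not_not] at hx ⊢
  ext i
  simp [complexify, hx]

theorem contDiff_component {u : R3 → R3} (hu : ContDiff ℝ ∞ u) (i : Fin 3) :
    ContDiff ℝ ∞ fun x => (u x i : ℂ) :=
  Complex.ofRealCLM.contDiff.comp (contDiff_euclidean.1 hu i)

theorem hasCompactSupport_component {u : R3 → R3} (hc : HasCompactSupport u) (i : Fin 3) :
    HasCompactSupport fun x => (u x i : ℂ) := by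
  refine hc.mono fun x hx => ?_
  contrapose! hx
  simp only [Function.mem_support, not_not] at hx ⊢
  simp [hx]

/-- The components of a test vector field as Schwartz functions. -/
noncomputable def componentSchwartz {u : R3 → R3} (hu : ContDiff ℝ ∞ u) (hc : HasCompactSupport u)
    (i : Fin 3) : SchwartzMap R3 ℂ :=
  (hasCompactSupport_component hc i).toSchwartzMap (contDiff_component hu i)

/-- The complexified vector field as a Schwartz function. -/
noncomputable def complexifySchwartz {u : R3 → R3} (hu : ContDiff ℝ ∞ u)
    (hc : HasCompactSupport u) : SchwartzMap R3 C3 :=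
  (hasCompactSupport_complexify hc).toSchwartzMap (contDiff_complexify hu)

theorem coe_complexifySchwartz {u : R3 → R3} (hu : ContDiff ℝ ∞ u) (hc : HasCompactSupport u) :
    (complexifySchwartz hu hc : R3 → C3) = complexify u := rfl

theorem fderiv_componentSchwartz {u : R3 → R3} (hu : ContDiff ℝ ∞ u) (hc : HasCompactSupport u)
    (i : Fin 3) (x m : R3) :
    fderiv ℝ (componentSchwartz hu hc i) x m = ((fderiv ℝ u x m) i : ℂ) := by
  have h1 : HasFDerivAt u (fderiv ℝ u x) x :=
    (hu.differentiable (by simp)).differentiableAt.hasFDerivAt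
  have h2 := Complex.ofRealCLM.hasFDerivAt.comp x
    (((EuclideanSpace.proj i : R3 →L[ℝ] ℝ).hasFDerivAt).comp x h1)
  have h3 := HasFDerivAt.fderiv h2
  calc fderiv ℝ (componentSchwartz hu hc i) x m
      = fderiv ℝ (Complex.ofRealCLM ∘ (EuclideanSpace.proj i : R3 →L[ℝ] ℝ)
        ∘ u) x m := rfl
    _ = _ := by rw [h3]; rfl

theorem fderiv_complexify_apply {u : R3 → R3} (hu : ContDiff ℝ ∞ u) (hc : HasCompactSupport u)
    (x m : R3) (k : Fin 3) :
    (fderiv ℝ (complexify u) x m) k = fderiv ℝ (componentSchwartz hu hc k) x m := by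
  have h1 : HasFDerivAt (complexify u) (fderiv ℝ (complexify u) x) x :=
    ((contDiff_complexify hu).differentiable (by simp)).differentiableAt.hasFDerivAt
  have h2 := ((EuclideanSpace.proj k : C3 →L[ℂ] ℂ).restrictScalars
    ℝ).hasFDerivAt.comp x h1
  have h3 := HasFDerivAt.fderiv h2
  calc (fderiv ℝ (complexify u) x m) k
      = fderiv ℝ (((EuclideanSpace.proj k : C3 →L[ℂ] ℂ).restrictScalars
    ℝ) ∘ complexify u) x m := by rw [h3]; rfl
    _ = _ := rfl

theorem R3.sum_smul_single (m : R3) : ∑ i, m i • EuclideanSpace.single i (1 : ℝ) = m := by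
  ext j
  simp [Pi.single_apply]

theorem R3.map_eq_sum {F : Type*} [NormedAddCommGroup F] [NormedSpace ℝ F] (L : R3 →L[ℝ] F)
    (m : R3) : L m = ∑ i, m i • L (EuclideanSpace.single i (1 : ℝ)) := by
  conv_lhs => rw [← R3.sum_smul_single m]
  simp

theorem fourier_complexify_apply {u : R3 → R3} (hu : ContDiff ℝ ∞ u) (hc : HasCompactSupport u)
    (ξ : R3) (i : Fin 3) :
    (𝓕 (complexify u) ξ) i = (𝓕 (componentSchwartz hu hc i) : SchwartzMap R3 ℂ) ξ := by
  have h : Integrable (complexify u) := (complexifySchwartz hu hc).integrable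
  rw [fourier_apply_coord h, SchwartzMap.fourier_coe]
  rfl

theorem sum_mul_fourier_component_eq_zero {u : R3 → R3} (hu : ContDiff ℝ ∞ u)
    (hc : HasCompactSupport u) (hdiv : DivergenceFree u) (ξ : R3) :
    ∑ i, (ξ i : ℂ) * (𝓕 (componentSchwartz hu hc i) : SchwartzMap R3 ℂ) ξ = 0 := by
  set D : Fin 3 → SchwartzMap R3 ℂ := fun i =>
    LineDeriv.lineDerivOp (EuclideanSpace.single i (1 : ℝ)) (componentSchwartz hu hc i) with hD
  have h0 : ∑ i, D i = 0 := by
    ext x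
    rw [sum_apply]
    simp only [hD, SchwartzMap.lineDerivOp_apply_eq_fderiv, fderiv_componentSchwartz]
    have := hdiv x
    rw [← Complex.ofReal_sum, this]
    simp
  have h1 : (∑ i, (𝓕 (D i) : SchwartzMap R3 ℂ)) = 0 := by
    rw [← FourierTransform.fourier_sum, h0, FourierTransform.fourier_zero]
  have h2 := congrArg (fun f : SchwartzMap R3 ℂ => f ξ) h1
  simp only [sum_apply, hD, fourier_lineDeriv_apply] at h2
  have h3 : (2 * Real.pi * Complex.I) * ∑ i, (ξ i : ℂ) *
      (𝓕 (componentSchwartz hu hc i) : SchwartzMap R3 ℂ) ξ = 0 := by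
    rw [Finset.mul_sum, ← h2.trans (by rfl : (0 : SchwartzMap R3 ℂ) ξ = 0)]
    refine Finset.sum_congr rfl fun i _ => by ring
  exact (mul_eq_zero.1 h3).resolve_left (by simp [Real.pi_ne_zero])

theorem memLp_top_fderiv {u : R3 → R3} (hu : ContDiff ℝ ∞ u) (hc : HasCompactSupport u) :
    MemLp (fderiv ℝ u) ⊤ volume :=
  (hu.continuous_fderiv (by simp)).memLp_top_of_hasCompactSupport (hc.fderiv (𝕜 := ℝ)) volume

/-- The essential bound holds everywhere by continuity: the set where it fails is open and null,
hence empty. -/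
theorem norm_fderiv_le_normLinf {u : R3 → R3} (hu : ContDiff ℝ ∞ u) (hc : HasCompactSupport u)
    (x : R3) : ‖fderiv ℝ u x‖ ≤ normLinf (fderiv ℝ u) := by
  have hcont : Continuous (fderiv ℝ u) := hu.continuous_fderiv (by simp)
  have hae : ∀ᵐ y ∂(volume : Measure R3), ‖fderiv ℝ u y‖ ≤ normLinf (fderiv ℝ u) := by
    have hfin := (memLp_top_fderiv hu hc).2
    filter_upwards [ae_le_eLpNormEssSup (f := fderiv ℝ u) (μ := volume)] with y hy
    rw [normLinf, eLpNorm_exponent_top]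
    rw [eLpNorm_exponent_top] at hfin
    rw [← toReal_enorm]
    exact ENNReal.toReal_mono hfin.ne hy
  by_contra hlt
  push Not at hlt
  have hopen : IsOpen {y | normLinf (fderiv ℝ u) < ‖fderiv ℝ u y‖} :=
    isOpen_lt continuous_const hcont.norm
  have hzero : volume {y | normLinf (fderiv ℝ u) < ‖fderiv ℝ u y‖} = 0 := by
    have := ae_iff.1 hae
    simpa using this
  rw [hopen.measure_eq_zero_iff volume] at hzero
  exact (Set.eq_empty_iff_forall_notMem.1 hzero x) hlt

/-- The function is the Fourier transform of `(2πi)⁻¹ ∂_j u_i`, which is bounded by the sup norm of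
the gradient, so the Poisson maximum principle applies. -/
theorem poissonBounded_component {u : R3 → R3} (hu : ContDiff ℝ ∞ u) (hc : HasCompactSupport u)
    {M : ℝ} (hM : normLinf (fderiv ℝ u) ≤ M) (i j : Fin 3) :
    PoissonBounded (fun ξ : R3 =>
      (ξ j : ℂ) * (𝓕 (componentSchwartz hu hc i) : SchwartzMap R3 ℂ) ξ) M := by
  set f : SchwartzMap R3 ℂ := (2 * Real.pi * Complex.I : ℂ)⁻¹ •
    LineDeriv.lineDerivOp (EuclideanSpace.single j (1 : ℝ)) (componentSchwartz hu hc i) with hf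
  have e : (fun ξ : R3 => (ξ j : ℂ) * (𝓕 (componentSchwartz hu hc i) : SchwartzMap R3 ℂ) ξ)
      = 𝓕 (f : R3 → ℂ) := by
    ext ξ
    have hne : (2 * Real.pi * Complex.I : ℂ) ≠ 0 := by simp [Real.pi_ne_zero]
    rw [← SchwartzMap.fourier_coe, hf, FourierTransform.fourier_smul, smul_apply,
      fourier_lineDeriv_apply, smul_eq_mul]
    field_simp
  have hn : ‖(2 * Real.pi * Complex.I : ℂ)⁻¹‖ ≤ 1 := by
    rw [norm_inv]
    refine inv_le_one_of_one_le₀ ?_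
    simp [abs_of_pos Real.pi_pos]
    linarith [Real.pi_gt_three]
  have hb : ∀ x, ‖f x‖ ≤ M := by
    intro x
    rw [hf, smul_apply, norm_smul, SchwartzMap.lineDerivOp_apply_eq_fderiv,
      fderiv_componentSchwartz, Complex.norm_real]
    refine (mul_le_of_le_one_left (norm_nonneg _) hn).trans ?_
    refine (PiLp.norm_apply_le _ i).trans ?_
    refine (ContinuousLinearMap.le_opNorm _ _).trans ?_
    rw [PiLp.norm_single, norm_one, mul_one]
    exact (norm_fderiv_le_normLinf hu hc x).trans hM
  rw [e]
  refine ⟨?_, fun t ht x => norm_fourierInv_poisson_mul_fourier_le f hb ht x⟩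
  rw [← SchwartzMap.fourier_coe]
  exact SchwartzMap.integrable _

end VectorField

/-! ### Fractional Laplacians of Schwartz functions in `L²`. -/

section FractionalLaplacian

theorem rpow_le_one_add_sq {r p : ℝ} (hr : 0 ≤ r) (hp : 0 ≤ p) (hp2 : p ≤ 2) :
    r ^ p ≤ 1 + r ^ 2 := by
  rcases le_total r 1 with h | h
  · have := Real.rpow_le_one hr h hp
    nlinarith [sq_nonneg r]
  · have := Real.rpow_le_rpow_of_exponent_le h hp2
    rw [Real.rpow_two] at this
    linarith

/-- For `0 ≤ s ≤ 1` the symbol is at most `1 + (2π‖ξ‖)²`, which Schwartz decay absorbs; this range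
covers `1/2`, `1/2 + σ` and `1`. -/
theorem integrable_memLp_multiplier (f : SchwartzMap R3 C3) {s : ℝ} (hs : 0 ≤ s) (hs1 : s ≤ 1) :
    Integrable (fun ξ : R3 => (((2 * Real.pi * ‖ξ‖) ^ (2 * s) : ℝ) : ℂ) • f ξ) ∧
      MemLp (fun ξ : R3 => (((2 * Real.pi * ‖ξ‖) ^ (2 * s) : ℝ) : ℂ) • f ξ) 2 := by
  have hc : Continuous fun ξ : R3 => (((2 * Real.pi * ‖ξ‖) ^ (2 * s) : ℝ) : ℂ) • f ξ := by
    refine (Complex.continuous_ofReal.comp ?_).smul f.continuous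
    exact (continuous_const.mul continuous_norm).rpow_const fun x => Or.inr (by linarith)
  have hle : ∀ ξ : R3, ‖(((2 * Real.pi * ‖ξ‖) ^ (2 * s) : ℝ) : ℂ) • f ξ‖
      ≤ ‖f ξ‖ + (2 * Real.pi) ^ 2 * (‖ξ‖ ^ 2 * ‖f ξ‖) := by
    intro ξ
    rw [norm_smul, Complex.norm_real, Real.norm_of_nonneg (by positivity)]
    have := mul_le_mul_of_nonneg_right (rpow_le_one_add_sq (r := 2 * Real.pi * ‖ξ‖) (p := 2 * s)
      (by positivity) (by linarith) (by linarith)) (norm_nonneg (f ξ))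
    linarith [this, (by ring : (1 + (2 * Real.pi * ‖ξ‖) ^ 2) * ‖f ξ‖
      = ‖f ξ‖ + (2 * Real.pi) ^ 2 * (‖ξ‖ ^ 2 * ‖f ξ‖))]
  obtain ⟨C0, hC0⟩ := f.decay 0 0
  obtain ⟨C2, hC2⟩ := f.decay 2 0
  have hi : Integrable (fun ξ : R3 => (((2 * Real.pi * ‖ξ‖) ^ (2 * s) : ℝ) : ℂ) • f ξ) :=
    (f.integrable.norm.add ((f.integrable_pow_mul volume 2).const_mul _)).mono'
      hc.aestronglyMeasurable (Filter.Eventually.of_forall hle)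
  refine ⟨hi, memLp_two_of_integrable_of_bounded hi (B := C0 + (2 * Real.pi) ^ 2 * C2) fun ξ => ?_⟩
  refine (hle ξ).trans ?_
  have h0 : ‖f ξ‖ ≤ C0 := by simpa using hC0.2 ξ
  have h2 : ‖ξ‖ ^ 2 * ‖f ξ‖ ≤ C2 := by simpa using hC2.2 ξ
  gcongr

theorem memLp_fracLaplacian (f : SchwartzMap R3 C3) {s : ℝ} (hs : 0 ≤ s) (hs1 : s ≤ 1) :
    MemLp (fracLaplacian s (f : R3 → C3)) 2 volume := by
  obtain ⟨h1, h2⟩ := integrable_memLp_multiplier (𝓕 f) hs hs1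
  rw [SchwartzMap.fourier_coe] at h1 h2
  exact (memLp_fourierInv_and_eLpNorm h1 h2).1

theorem normL2_fracLaplacian_half_sq (f : SchwartzMap R3 C3) :
    normL2 (fracLaplacian (1 / 2) (f : R3 → C3)) ^ 2
      = (2 * Real.pi) ^ 2 * ∫ ξ : R3, ‖ξ‖ ^ 2 * ‖(𝓕 f : SchwartzMap R3 C3) ξ‖ ^ 2 := by
  obtain ⟨h1, h2⟩ := integrable_memLp_multiplier (𝓕 f) (s := 1 / 2) (by norm_num) (by norm_num)
  rw [normL2, toReal_eLpNorm_two_sq (memLp_fracLaplacian f (by norm_num) (by norm_num)),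
    fracLaplacian, ← SchwartzMap.fourier_coe, integral_norm_sq_fourierInv h1 h2,
    ← integral_const_mul]
  refine integral_congr_ae (Filter.Eventually.of_forall fun ξ => ?_)
  simp only [norm_smul, Complex.norm_real]
  rw [Real.norm_of_nonneg (by positivity)]
  norm_num
  ring

theorem integral_component_le (f : SchwartzMap R3 C3) (i : Fin 3) :
    ∫ ξ : R3, ‖ξ‖ ^ 2 * ‖f ξ i‖ ^ 2 ≤ ∫ ξ : R3, ‖ξ‖ ^ 2 * ‖f ξ‖ ^ 2 := by
  obtain ⟨-, h2⟩ := integrable_memLp_multiplier f (s := 1 / 2) (by norm_num) (by norm_num)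
  have h3 : Integrable fun ξ : R3 => ‖ξ‖ ^ 2 * ‖f ξ‖ ^ 2 := by
    refine ((h2.integrable_norm_pow (by norm_num)).const_mul ((2 * Real.pi) ^ 2)⁻¹).congr
      (Filter.Eventually.of_forall fun ξ => ?_)
    simp only [norm_smul, Complex.norm_real]
    rw [Real.norm_of_nonneg (by positivity)]
    norm_num
    field_simp
  have hle : ∀ ξ : R3, ‖ξ‖ ^ 2 * ‖f ξ i‖ ^ 2 ≤ ‖ξ‖ ^ 2 * ‖f ξ‖ ^ 2 := fun ξ => by
    gcongr
    exact PiLp.norm_apply_le _ i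
  refine integral_mono (h3.mono' (Continuous.aestronglyMeasurable (by fun_prop))
    (Filter.Eventually.of_forall fun ξ => ?_)) h3 hle
  rw [Real.norm_of_nonneg (by positivity)]
  exact hle ξ

end FractionalLaplacian

/-! ### The physical commutator as an inverse Fourier transform, and its estimate. -/

section CommutatorFormula

variable {u : R3 → R3}

/-- The Fourier transforms of the partial derivatives of the `k`-th component. -/
noncomputable def gradientFourier (hu : ContDiff ℝ ∞ u) (hc : HasCompactSupport u) (k i : Fin 3) :
    SchwartzMap R3 ℂ :=
  𝓕 (LineDeriv.lineDerivOp (EuclideanSpace.single i (1 : ℝ)) (componentSchwartz hu hc k))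

theorem fourierInv_fourier_component (hu : ContDiff ℝ ∞ u) (hc : HasCompactSupport u) (i : Fin 3)
    (x : R3) :
    𝓕⁻ ((𝓕 (componentSchwartz hu hc i) : SchwartzMap R3 ℂ) : R3 → ℂ) x = (u x i : ℂ) := by
  rw [← SchwartzMap.fourierInv_coe, FourierTransform.fourierInv_fourier_eq]
  rfl

theorem advect_complexify_apply (hu : ContDiff ℝ ∞ u) (hc : HasCompactSupport u) (k : Fin 3) :
    (fun x => advect u (complexify u) x k) = 𝓕⁻ (fun ξ => ∑ i,
      mulConv (𝓕 (componentSchwartz hu hc i) : SchwartzMap R3 ℂ) (gradientFourier hu hc k i) ξ) := by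
  funext x
  rw [fourierInv_sum_apply fun i => (NiceFunction.mulConv (SchwartzMap.integrable _)
    (niceFunction_schwartz _)).1, advect, fderiv_complexify_apply hu hc, R3.map_eq_sum]
  refine Finset.sum_congr rfl fun i _ => ?_
  rw [fourierInv_mulConv (SchwartzMap.integrable _) (SchwartzMap.integrable _),
    fourierInv_fourier_component, gradientFourier, ← SchwartzMap.fourierInv_coe,
    FourierTransform.fourierInv_fourier_eq, SchwartzMap.lineDerivOp_apply_eq_fderiv,
    Complex.real_smul]

theorem fourier_advect_complexify_apply (hu : ContDiff ℝ ∞ u) (hc : HasCompactSupport u)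
    (k : Fin 3) (ξ : R3) :
    𝓕 (fun x => advect u (complexify u) x k) ξ = ∑ i,
      mulConv (𝓕 (componentSchwartz hu hc i) : SchwartzMap R3 ℂ) (gradientFourier hu hc k i) ξ := by
  set C : SchwartzMap R3 ℂ := ∑ i, SchwartzMap.convolution (ContinuousLinearMap.mul ℂ ℂ)
    (𝓕 (componentSchwartz hu hc i) : SchwartzMap R3 ℂ) (gradientFourier hu hc k i) with hC
  have hCe : (fun ξ => ∑ i, mulConv (𝓕 (componentSchwartz hu hc i) : SchwartzMap R3 ℂ)
      (gradientFourier hu hc k i) ξ) = C := by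
    funext ξ
    rw [hC, sum_apply]
    simp only [mulConv_schwartz]
  rw [advect_complexify_apply hu hc, hCe, ← SchwartzMap.fourierInv_coe,
    ← SchwartzMap.fourier_coe, FourierTransform.fourier_fourierInv_eq, ← hCe]

theorem contDiff_advect_complexify (hu : ContDiff ℝ ∞ u) : ContDiff ℝ ∞ (advect u (complexify u)) :=
  ((contDiff_complexify hu).fderiv_right (m := ∞) (by simp)).clm_apply hu

theorem hasCompactSupport_advect_complexify (hc : HasCompactSupport u) :
    HasCompactSupport (advect u (complexify u)) := by
  refine hc.mono fun x hx => ?_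
  contrapose! hx
  simp only [Function.mem_support, not_not] at hx ⊢
  simp [advect, hx]

/-- Multiplication by `u_i` is convolution with its Fourier transform, while `Λ` multiplies by
`2π‖ξ‖` outside the convolution in one term and inside it in the other. -/
theorem advectionCommutator_apply (hu : ContDiff ℝ ∞ u) (hc : HasCompactSupport u) (x : R3)
    (k : Fin 3) :
    (advectionCommutator (1 / 2) u x) k = 𝓕⁻ (commutatorKernel
      (fun i => 𝓕 (componentSchwartz hu hc i)) (gradientFourier hu hc k)) x := by
  set v : SchwartzMap R3 C3 := (hasCompactSupport_advect_complexify hc).toSchwartzMap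
    (contDiff_advect_complexify hu) with hv
  have hvc : (v : R3 → C3) = advect u (complexify u) := rfl
  set U : Fin 3 → SchwartzMap R3 ℂ := fun i => 𝓕 (componentSchwartz hu hc i) with hU
  set G := gradientFourier hu hc k with hG
  have hsymb : ∀ ξ : R3, (2 * Real.pi * ‖ξ‖) ^ (2 * (1 / 2) : ℝ) = 2 * Real.pi * ‖ξ‖ := by
    intro ξ; norm_num
  have hn1 : ∀ i, NiceFunction fun ξ => ((2 * Real.pi * ‖ξ‖ : ℝ) : ℂ) * mulConv (U i) (G i) ξ := by
    intro i
    rw [← mulConv_schwartz]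
    exact niceFunction_norm_mul_schwartz _
  have hn2 : ∀ i, NiceFunction (mulConv (U i) fun η => ((2 * Real.pi * ‖η‖ : ℝ) : ℂ) * G i η) :=
    fun i => NiceFunction.mulConv (U i).integrable (niceFunction_norm_mul_schwartz (G i))
  have e1 : (fracLaplacian (1 / 2) (advect u (complexify u)) x) k
      = ∑ i, 𝓕⁻ (fun ξ => ((2 * Real.pi * ‖ξ‖ : ℝ) : ℂ) * mulConv (U i) (G i) ξ) x := by
    obtain ⟨h1, -⟩ := integrable_memLp_multiplier (𝓕 v) (s := 1 / 2) (by norm_num) (by norm_num)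
    rw [SchwartzMap.fourier_coe, hvc] at h1
    rw [fracLaplacian, fourierInv_apply_coord h1, ← fourierInv_sum_apply fun i => (hn1 i).1]
    refine congrFun (congrArg _ (funext fun ξ => ?_)) x
    rw [PiLp.smul_apply, fourier_apply_coord (hvc ▸ v.integrable),
      fourier_advect_complexify_apply hu hc, hsymb, smul_eq_mul, Finset.mul_sum]
  have e2 : (advect u (fracLaplacian (1 / 2) (complexify u)) x) k
      = ∑ i, 𝓕⁻ (mulConv (U i) fun η => ((2 * Real.pi * ‖η‖ : ℝ) : ℂ) * G i η) x := by
    set f := complexifySchwartz hu hc with hf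
    obtain ⟨h1, -⟩ := integrable_memLp_multiplier (𝓕 f) (s := 1 / 2) (by norm_num) (by norm_num)
    have h2 : Integrable fun ξ : R3 => ‖ξ‖ * ‖(((2 * Real.pi * ‖ξ‖) ^ (2 * (1 / 2) : ℝ) : ℝ) : ℂ) •
        (𝓕 f : SchwartzMap R3 C3) ξ‖ := by
      refine (((𝓕 f : SchwartzMap R3 C3).integrable_pow_mul volume 2).const_mul
        (2 * Real.pi)).congr (Filter.Eventually.of_forall fun ξ => ?_)
      simp only [hsymb, norm_smul, Complex.norm_real]
      rw [Real.norm_of_nonneg (by positivity)]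
      ring
    rw [SchwartzMap.fourier_coe, hf, coe_complexifySchwartz] at h1 h2
    rw [advect, fracLaplacian, fderiv_fourierInv_apply_coord h1 h2]
    -- At the fixed point `x` the convolution becomes multiplication by the number `u x i`, so both
    -- sides can be compared under a single Fourier integral.
    have h3 : ∀ i, 𝓕⁻ (mulConv (U i) fun η => ((2 * Real.pi * ‖η‖ : ℝ) : ℂ) * G i η) x
        = 𝓕⁻ (fun η => (u x i : ℂ) * (((2 * Real.pi * ‖η‖ : ℝ) : ℂ) * G i η)) x := by
      intro i
      rw [fourierInv_mulConv (U i).integrable (niceFunction_norm_mul_schwartz (G i)).1,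
        fourierInv_const_mul_apply, hU, fourierInv_fourier_component]
    simp only [h3]
    rw [← fourierInv_sum_apply fun i => (niceFunction_norm_mul_schwartz (G i)).1.const_mul _]
    refine congrFun (congrArg _ (funext fun ξ => ?_)) x
    have h4 : ((inner ℝ ξ (u x) : ℝ) : ℂ) = ∑ i, (u x i : ℂ) * (ξ i : ℂ) := by
      rw [PiLp.inner_apply]
      push_cast
      simp
    rw [PiLp.smul_apply, fourier_complexify_apply hu hc, h4, hsymb, smul_eq_mul, Finset.mul_sum,
      Finset.sum_mul]
    refine Finset.sum_congr rfl fun i _ => ?_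
    rw [hG, gradientFourier, fourier_lineDeriv_apply]
    ring
  rw [advectionCommutator, PiLp.sub_apply, e1, e2, ← Finset.sum_sub_distrib]
  simp only [← fourierInv_sub_apply (hn1 _).1 (hn2 _).1]
  exact (fourierInv_sum_apply (fun i => ((hn1 i).1.sub (hn2 i).1)) x).symm

/-- The Fourier transform of the commutator. -/
noncomputable def commutatorFourier (hu : ContDiff ℝ ∞ u) (hc : HasCompactSupport u) : R3 → C3 :=
  fun ξ => WithLp.toLp 2 fun k =>
    commutatorKernel (fun i => 𝓕 (componentSchwartz hu hc i)) (gradientFourier hu hc k) ξ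

theorem C3.norm_le_sum (z : C3) : ‖z‖ ≤ ∑ k, ‖z k‖ := by
  rw [EuclideanSpace.norm_eq]
  refine Real.sqrt_le_iff.2 ⟨by positivity, ?_⟩
  simp only [Fin.sum_univ_three]
  nlinarith [mul_nonneg (norm_nonneg (z 0)) (norm_nonneg (z 1)),
    mul_nonneg (norm_nonneg (z 0)) (norm_nonneg (z 2)),
    mul_nonneg (norm_nonneg (z 1)) (norm_nonneg (z 2))]

theorem integrable_memLp_commutatorFourier (hu : ContDiff ℝ ∞ u) (hc : HasCompactSupport u) :
    Integrable (commutatorFourier hu hc) ∧ MemLp (commutatorFourier hu hc) 2 := by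
  have h := fun k => niceFunction_commutatorKernel
    (fun i => 𝓕 (componentSchwartz hu hc i)) (gradientFourier hu hc k)
  choose h1 h2 B hB using h
  have hcont : Continuous (commutatorFourier hu hc) :=
    (PiLp.continuous_toLp 2 _).comp (continuous_pi h2)
  have hi : Integrable (commutatorFourier hu hc) :=
    (integrable_finsetSum Finset.univ fun k _ => (h1 k).norm).mono' hcont.aestronglyMeasurable
      (Filter.Eventually.of_forall fun ξ => C3.norm_le_sum _)
  exact ⟨hi, memLp_two_of_integrable_of_bounded hi (B := ∑ k, B k) fun ξ =>
    (C3.norm_le_sum _).trans (Finset.sum_le_sum fun k _ => hB k ξ)⟩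

theorem advectionCommutator_eq_fourierInv (hu : ContDiff ℝ ∞ u) (hc : HasCompactSupport u) :
    advectionCommutator (1 / 2) u = 𝓕⁻ (commutatorFourier hu hc) := by
  funext x
  ext k
  rw [advectionCommutator_apply hu hc,
    fourierInv_apply_coord (integrable_memLp_commutatorFourier hu hc).1]
  rfl

theorem memLp_advectionCommutator (hu : ContDiff ℝ ∞ u) (hc : HasCompactSupport u) :
    MemLp (advectionCommutator (1 / 2) u) 2 volume := by
  rw [advectionCommutator_eq_fourierInv hu hc]
  exact (memLp_fourierInv_and_eLpNorm (integrable_memLp_commutatorFourier hu hc).1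
    (integrable_memLp_commutatorFourier hu hc).2).1

/-- The commutator estimate of Calderón type. -/
theorem normL2_advectionCommutator_le (hu : ContDiff ℝ ∞ u) (hc : HasCompactSupport u)
    (hdiv : DivergenceFree u) :
    normL2 (advectionCommutator (1 / 2) u) ≤ 5760 * Real.pi ^ 2 * normLinf (fderiv ℝ u)
      * normL2 (fracLaplacian (1 / 2) (complexify u)) := by
  set X := normL2 (fracLaplacian (1 / 2) (complexify u)) with hX
  have hX0 : 0 ≤ X := ENNReal.toReal_nonneg
  have hL0 : 0 ≤ normLinf (fderiv ℝ u) := ENNReal.toReal_nonneg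
  set f := complexifySchwartz hu hc with hf
  set E := ∫ ξ : R3, ‖ξ‖ ^ 2 * ‖(𝓕 f : SchwartzMap R3 C3) ξ‖ ^ 2 with hE
  have hXE : X ^ 2 = (2 * Real.pi) ^ 2 * E := normL2_fracLaplacian_half_sq f
  have hE0 : 0 ≤ E := integral_nonneg fun ξ => by positivity
  have hcomp : ∀ i, ∫ ξ : R3, ‖ξ‖ ^ 2 *
      ‖(𝓕 (componentSchwartz hu hc i) : SchwartzMap R3 ℂ) ξ‖ ^ 2 ≤ E := by
    intro i
    refine le_trans (le_of_eq ?_) (integral_component_le (𝓕 f) i)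
    refine integral_congr_ae (Filter.Eventually.of_forall fun ξ => ?_)
    simp only [← fourier_complexify_apply hu hc, SchwartzMap.fourier_coe]
    rfl
  obtain ⟨hK1, hK2⟩ := integrable_memLp_commutatorFourier hu hc
  have hsq : normL2 (advectionCommutator (1 / 2) u) ^ 2 = ∑ k, ∫ ξ, ‖commutatorKernel
      (fun i => 𝓕 (componentSchwartz hu hc i)) (gradientFourier hu hc k) ξ‖ ^ 2 := by
    rw [normL2, toReal_eLpNorm_two_sq (memLp_advectionCommutator hu hc),
      advectionCommutator_eq_fourierInv hu hc, integral_norm_sq_fourierInv hK1 hK2,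
      ← integral_finsetSum]
    · refine integral_congr_ae (Filter.Eventually.of_forall fun ξ => ?_)
      simp only [EuclideanSpace.norm_sq_eq]
      rfl
    · intro k _
      obtain ⟨h1, -, B, hB⟩ := niceFunction_commutatorKernel
        (fun i => 𝓕 (componentSchwartz hu hc i)) (gradientFourier hu hc k)
      exact (memLp_two_of_integrable_of_bounded h1 hB).integrable_norm_pow (by norm_num)
  -- The multiplier estimate needs `M > 0`, so it is applied above the norm and the excess is sent
  -- to zero at the end.
  have hM : ∀ M, normLinf (fderiv ℝ u) < M →
      normL2 (advectionCommutator (1 / 2) u) ≤ 5760 * Real.pi ^ 2 * M * X := by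
    intro M hML
    have hM0 : 0 < M := hL0.trans_lt hML
    refine le_of_sq_le_sq ?_ (by positivity)
    rw [hsq]
    refine (Finset.sum_le_sum fun k _ => integral_norm_sq_commutatorKernel_le _ _ k
      (fun i ξ => fourier_lineDeriv_apply _ i ξ)
      (sum_mul_fourier_component_eq_zero hu hc hdiv) hM0
      (fun i j => poissonBounded_component hu hc hML.le i j) hcomp).trans ?_
    rw [mul_pow _ X, hXE, Finset.sum_const, Finset.card_univ, Fintype.card_fin, nsmul_eq_mul]
    -- The sum over three components is absorbed by the factor `(2π)²` relating `E` to `‖Λu‖₂²`.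
    have h3 : (3 : ℝ) ≤ (2 * Real.pi) ^ 2 := by nlinarith [Real.pi_gt_three]
    have h4 : 0 ≤ (5760 * Real.pi ^ 2 * M) ^ 2 * E := by positivity
    push_cast
    nlinarith
  refine le_of_forall_pos_le_add fun ε hε => ?_
  have hden : 0 < 5760 * Real.pi ^ 2 * (X + 1) := by positivity
  have h := hM (normLinf (fderiv ℝ u) + ε / (5760 * Real.pi ^ 2 * (X + 1)))
    (lt_add_of_pos_right _ (by positivity))
  refine h.trans ?_
  have e : 5760 * Real.pi ^ 2 * (normLinf (fderiv ℝ u) + ε / (5760 * Real.pi ^ 2 * (X + 1))) * X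
      = 5760 * Real.pi ^ 2 * normLinf (fderiv ℝ u) * X + ε * (X / (X + 1)) := by
    field_simp
  rw [e]
  have : X / (X + 1) ≤ 1 := div_le_one_of_le₀ (by linarith) (by linarith)
  gcongr
  exact mul_le_of_le_one_right hε.le this

end CommutatorFormula

/-! ### Insertion of the logarithmic factors. -/

/-- The lower bound `c ≤ F` pays for the first logarithmic factor; the second term is nonnegative
and is simply added. -/
theorem le_add_of_le_div_mul {c K l X Y F G : ℝ} (hc : 0 < c) (hF : c ≤ F) (hG : 0 ≤ G)
    (hK : 0 ≤ K) (hl : 0 ≤ l) (hX : 0 ≤ X) (hY : 0 ≤ Y) :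
    K * l * X ≤ K / c * l * X * F + K / c * l * Y * G := by
  have h : K * l * X = K / c * l * X * c := by field_simp
  rw [h]
  exact (mul_le_mul_of_nonneg_left hF (by positivity)).trans
    (le_add_of_nonneg_right (by positivity))

theorem theorem3 (δ : ℕ → ℝ) (hδ : ∀ j, 1 ≤ j → 0 < δ j) (hsum : Summable δ) :
    (∀ Z : ℝ, 0 ≤ Z →
      Multipliable (fun j : ℕ => (1 + nestedLog (j + 2) Z) ^ (-δ (j + 2))) ∧
      Multipliable (fun j : ℕ => (1 + nestedLog (j + 2) Z) ^ (δ (j + 2)))) ∧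
    ∃ C : ℝ, 0 < C ∧ ∀ σ : ℝ, 0 < σ → σ < 1 / 2 →
      ∀ u : R3 → R3, ContDiff ℝ ∞ u → HasCompactSupport u → DivergenceFree u →
        MemLp (fderiv ℝ u) ⊤ volume ∧
        MemLp (fracLaplacian (1 / 2) (complexify u)) 2 volume ∧
        MemLp (fracLaplacian 1 (complexify u)) 2 volume ∧
        MemLp (fracLaplacian (1 / 2 + σ) (complexify u)) 2 volume ∧
        MemLp (advectionCommutator (1 / 2) u) 2 volume ∧
        normL2 (advectionCommutator (1 / 2) u) ≤
          C * normLinf (fderiv ℝ u) * normL2 (fracLaplacian (1 / 2) (complexify u)) *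
              logFactorOne δ (normL2 (fracLaplacian (1 / 2 + σ) (complexify u))) +
          C * normLinf (fderiv ℝ u) * normL2 (fracLaplacian 1 (complexify u)) *
              logFactorTwo δ (normL2 (fracLaplacian (1 / 2 + σ) (complexify u))) := by
  refine ⟨fun Z hZ => multipliable_nestedLog hδ hsum hZ, ?_⟩
  obtain ⟨c, hc0, hc⟩ := exists_le_logFactorOne hδ hsum
  refine ⟨5760 * Real.pi ^ 2 / c, by positivity, fun σ hσ hσ2 u hu hcs hdiv => ?_⟩
  set f := complexifySchwartz hu hcs with hf
  refine ⟨memLp_top_fderiv hu hcs, memLp_fracLaplacian f (by norm_num) (by norm_num),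
    memLp_fracLaplacian f (by norm_num) le_rfl, memLp_fracLaplacian f (by linarith) (by linarith),
    memLp_advectionCommutator hu hcs, ?_⟩
  set Z := normL2 (fracLaplacian (1 / 2 + σ) (complexify u)) with hZ
  have hZ0 : 0 ≤ Z := ENNReal.toReal_nonneg
  have hX0 : 0 ≤ normL2 (fracLaplacian (1 / 2) (complexify u)) := ENNReal.toReal_nonneg
  have hY0 : 0 ≤ normL2 (fracLaplacian 1 (complexify u)) := ENNReal.toReal_nonneg
  have hL0 : 0 ≤ normLinf (fderiv ℝ u) := ENNReal.toReal_nonneg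
  have h2 := logFactorTwo_nonneg hδ hsum hZ0
  refine (normL2_advectionCommutator_le hu hcs hdiv).trans ?_
  exact le_add_of_le_div_mul hc0 (hc Z hZ0) h2 (by positivity) hL0 hX0 hY0
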